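/- Let $X$ be a nonempty standard Borel space and $\mathcal R$ a Borel equivalence relation with countable classes on $X$. All graphs are graphs in the sense of Serre: vertices, oriented edges, origin $o$, terminus $t$, and a fixed-point free involution $a\mapsto\bar a$ with $o(\bar a)=t(a)$. **Arboretums.** An *$\mathcal R$-space* is a standard Borel space $F$ with a Borel map $\pi:F\to X$ with countable fibres and a Borel action $((x,y),f)\mapsto (x,y)\cdot f\in\pi^{-1}(x)$, for $x\,\mathcal R\,y$ and $f\in\pi^{-1}(y)$, such that $(z,z)\cdot f=f$ and $(x,y)\cdot((y,z)\cdot f)=(x,z)\cdot f$; $\mathcal R_F$ denotes the orbit equivalence relation on $F$. An *$\mathcal R$-arboretum* $\mathcal A$ on $X$ is a graph whose sets of vertices $\mathcal A^0$ and of edges $\mathcal A^1$ are $\mathcal R$-spaces, for which $o,t,\bar{\ }$ are Borel, fibre-preserving and $\mathcal R$-equivariant, and whose fibre $\mathcal A_x$ is a tree for every $x\in X$ (edge fibres may be empty). **Graphs of relations.** A *graph of relations* $G^r$ is a countable graph $G$ with, for each vertex $P$ and each edge $a$, a standard Borel space $Y_P$, resp. $Y_a$, with a countable Borel equivalence relation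 $\mathcal R_P$, resp. $\mathcal R_a$, such that $(Y_{\bar a},\mathcal R_{\bar a})=(Y_a,\mathcal R_a)$, and for each edge $a$ an injective Borel map $i_a:Y_a\to Y_{t(a)}$ sending $\mathcal R_a$-equivalent points to $\mathcal R_{t(a)}$-equivalent points. A *rooted maximal subtree* of $G^r$ is a subtree $T$ of $G$ containing all vertices, with a vertex (root) $P_0$ such that $Y_{P_0}$ meets exactly once each class of the equivalence relation on $\bigsqcup_P Y_P$ generated by $i_{\bar a}(e)\sim i_a(e)$ ($a$ an edge of $T$, $e\in Y_a$). The points of $\bigsqcup_P Y_P$ and of $\bigsqcup_{a\in T}Y_a$ are then the vertices and the edges of an arboretum over $Y_{P_0}$, the edge $e\in Y_a$ going from $i_{\bar a}(e)$ to $i_a(e)$. A *representation* $\chi$ of the tree in $\mathcal A$ is an isomorphism of $Y_{P_0}$ with a Borel subset of $X$ and a compatible injective Borel graph morphism from this arboretum into $\mathcal A$, which identifies $\mathcal R_P$ and $\mathcal R_a$ ($a\in T$) with the restrictions of $\mathcal R_{\mathcal A^0}$ and $\mathcal R_{\mathcal A^1}$ to $\chi(Y_P)$ and $\chi(Y_a)$.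 Through $\pi\circ\chi$, each $Y_P$ is identified with a subset of $X$. **Theorem.** For every $\mathcal R$-arboretum $\mathcal A$ on $X$ there exists a desingularization of the action of $\mathcal R$ on $\mathcal A$, that is: a graph of relations $G^r$ with an orientation of $G$ (one edge chosen in each pair $\{a,\bar a\}$), a rooted maximal subtree $T$, a representation $\chi$ of it in $\mathcal A$, and, for each edge $a\notin T$ of the orientation, a Borel isomorphism $\phi_a\in[[\mathcal R]]$ between Borel subsets of $X$, with graph in $\mathcal R$, such that 1. the base isomorphism of $\chi$ identifies $Y_{P_0}$ with all of $X$, and the $\mathcal R_{\mathcal A^0}$-saturations of the sets $\chi(Y_P)$, $P$ a vertex of $G$, form a partition of $\mathcal A^0$; 2. for each edge $a\notin T$ of the orientation there is a Borel section $s_a:\mathrm{dom}(\phi_a)\to\mathcal A^1$ of the projection such that, for all $x\in\mathrm{dom}(\phi_a)$, $o(s_a(x))\in\chi(Y_{o(a)})$ and $(\phi_a(x),x)\cdot t(s_a(x))\in\chi(Y_{t(a)})$; 3. for each such $a$, let $\mathrm{Stab}_{\mathcal R}(s_a)$ be the relation "$s_a(x)\,\mathcal R_{\mathcal A^1}\,s_a(y)$"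 on $\mathrm{dom}(\phi_a)$. Then $\pi\circ\chi$ induces an isomorphism of the image of $\mathcal R_a$ under $i_{\bar a}$ with $\mathrm{Stab}_{\mathcal R}(s_a)$, and of the image of $\mathcal R_a$ under $i_a$ with $\phi_a\mathrm{Stab}_{\mathcal R}(s_a)\phi_a^{-1}$ on $\phi_a(\mathrm{dom}(\phi_a))$, and these are compatible: $\phi_a(\pi\chi(i_{\bar a}(e)))=\pi\chi(i_a(e))$ for $e\in Y_a$; 4. the $\mathcal R_{\mathcal A^1}$-saturations of the sets $\chi(Y_a)$ ($a$ an edge of $T$, in both directions) and $s_a(\mathrm{dom}(\phi_a))$ ($a\notin T$ an edge of the orientation) form a partition of $\mathcal A^1$. Partitions are countable families of nonempty pairwise disjoint sets. -/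

import Mathlib

universe u v w

/-- A Borel equivalence relation with countable classes on a Borel space. -/
structure BorelEqRel (X : Type u) [MeasurableSpace X] extends Setoid X where
  measurableSet_graph : MeasurableSet {p : X × X | toSetoid p.1 p.2}
  countable_class : ∀ x, {y | toSetoid x y}.Countable

/-- A standard Borel space carrying a Borel equivalence relation with countable classes. -/
structure BorelRelSpace where
  carrier : Type u
  [meas : MeasurableSpace carrier]
  [std : StandardBorelSpace carrier]
  rel : BorelEqRel carrier

attribute [instance] BorelRelSpace.meas BorelRelSpace.std

/-- A family of sets is a partition of the ambient type: nonempty, pairwise disjoint members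
which cover everything. -/
def IsPartitionFamily {ι : Type u} {α : Type v} (s : ι → Set α) : Prop :=
  (∀ i, (s i).Nonempty) ∧ (∀ i j, i ≠ j → Disjoint (s i) (s j)) ∧ (⋃ i, s i) = Set.univ

/-! ### Graphs in the sense of Serre -/

/-- A graph with vertex set `V` and set of (oriented) edges `E`: origin, terminus, and a
fixed-point free involution `e ↦ inv e` (the opposite edge) exchanging origin and terminus. -/
structure SerreGraph (V : Type v) (E : Type w) where
  org : E → V
  ter : E → V
  inv : E → E
  inv_inv : ∀ e, inv (inv e) = e
  inv_ne : ∀ e, inv e ≠ e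
  org_inv : ∀ e, org (inv e) = ter e

namespace SerreGraph

variable {V : Type v} {E : Type w} (G : SerreGraph V E)

theorem ter_inv (e : E) : G.ter (G.inv e) = G.org e := by
  rw [← G.org_inv, G.inv_inv]

/-- The adjacency relation between distinct vertices. -/
def adjGraph : SimpleGraph V where
  Adj P Q := P ≠ Q ∧ ∃ e, G.org e = P ∧ G.ter e = Q
  symm := ⟨by
    rintro P Q ⟨hne, e, ho, ht⟩
    exact ⟨hne.symm, G.inv e, by rw [G.org_inv, ht], by rw [G.ter_inv, ho]⟩⟩
  loopless := ⟨fun _ h => h.1 rfl⟩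

/-- A tree: a nonempty connected graph without circuits, that is, without circuits of length `1`
(loops), of length `2` (multiple edges), or of length at least `3`. -/
def IsTree : Prop :=
  (∀ e, G.org e ≠ G.ter e) ∧
  (∀ e e', G.org e = G.org e' → G.ter e = G.ter e' → e = e') ∧
  G.adjGraph.IsTree

/-- The subgraph with the same vertices and with a set of edges stable under `inv`. -/
def restrictEdges (T : Set E) (hT : ∀ e ∈ T, G.inv e ∈ T) : SerreGraph V T where
  org e := G.org e
  ter e := G.ter e
  inv e := ⟨G.inv e, hT e e.2⟩
  inv_inv e := Subtype.ext (G.inv_inv e)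
  inv_ne e h := G.inv_ne e (congrArg Subtype.val h)
  org_inv e := G.org_inv e

end SerreGraph

/-! ### Actions of an equivalence relation on fibred spaces and fields of graphs -/

section Actions

variable {X : Type u} [MeasurableSpace X]

/-- A Borel projection `F → X` with countable fibres, together with a left action of `R`:
`act x t _` is `(x, y) · t`, where `y = proj t` is `R`-equivalent to `x`. -/
structure FiberedAction (R : BorelEqRel X) (F : Type v) [MeasurableSpace F] where
  proj : F → X
  measurable_proj : Measurable proj
  countable_fiber : ∀ x, (proj ⁻¹' {x}).Countable
  act : (x : X) → (t : F) → R.toSetoid x (proj t) → F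
  measurable_act :
    Measurable fun q : {q : X × F // R.toSetoid q.1 (proj q.2)} => act q.1.1 q.1.2 q.2
  proj_act : ∀ x t h, proj (act x t h) = x
  act_self : ∀ t, act (proj t) t (R.toSetoid.refl (proj t)) = t
  act_act : ∀ (x y : X) (t : F) (hxy : R.toSetoid x y) (hy : R.toSetoid y (proj t)),
    act x (act y t hy) ((proj_act y t hy).symm ▸ hxy) = act x t (R.toSetoid.trans hxy hy)

namespace FiberedAction

variable {R : BorelEqRel X} {F : Type v} [MeasurableSpace F] {F' : Type w} [MeasurableSpace F']

/-- The equivalence relation `R_F` on `F`: being in the same orbit. -/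
def OrbitRel (Φ : FiberedAction R F) (f f' : F) : Prop :=
  ∃ h : R.toSetoid (Φ.proj f) (Φ.proj f'), Φ.act (Φ.proj f) f' h = f

/-- The `R_F`-saturation of a subset of `F`. -/
def saturation (Φ : FiberedAction R F) (S : Set F) : Set F :=
  {f | ∃ f' ∈ S, Φ.OrbitRel f f'}

/-- Morphisms of fibred spaces with `R`-action: Borel, fibre preserving, equivariant. -/
structure IsMorphism (Φ : FiberedAction R F) (Φ' : FiberedAction R F') (f : F → F') : Prop where
  measurable : Measurable f
  proj_map : ∀ t, Φ'.proj (f t) = Φ.proj t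
  map_act : ∀ x t (h : R.toSetoid x (Φ.proj t)),
    f (Φ.act x t h) = Φ'.act x (f t) ((proj_map t).symm ▸ h)

end FiberedAction

/-- A Borel field of graphs on `X` with an action of `R`. The fibres of the vertex space are
nonempty; fibres of the edge space may be empty (a tree may consist of a single vertex). -/
structure BorelGraphField (R : BorelEqRel X) (V : Type v) (E : Type w)
    [MeasurableSpace V] [MeasurableSpace E] where
  vert : FiberedAction R V
  edge : FiberedAction R E
  vert_surjective : Function.Surjective vert.proj
  graph : SerreGraph V E
  org_morphism : edge.IsMorphism vert graph.org
  ter_morphism : edge.IsMorphism vert graph.ter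
  inv_morphism : edge.IsMorphism edge graph.inv

namespace BorelGraphField

variable {R : BorelEqRel X} {V : Type v} {E : Type w} [MeasurableSpace V] [MeasurableSpace E]

/-- The fibre over `x`. -/
def fiber (A : BorelGraphField R V E) (x : X) :
    SerreGraph {p : V // A.vert.proj p = x} {e : E // A.edge.proj e = x} where
  org e := ⟨A.graph.org e, (A.org_morphism.proj_map e).trans e.2⟩
  ter e := ⟨A.graph.ter e, (A.ter_morphism.proj_map e).trans e.2⟩
  inv e := ⟨A.graph.inv e, (A.inv_morphism.proj_map e).trans e.2⟩
  inv_inv e := Subtype.ext (A.graph.inv_inv e)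
  inv_ne e h := A.graph.inv_ne e (congrArg Subtype.val h)
  org_inv e := Subtype.ext (A.graph.org_inv e)

/-- An `R`-arboretum: every fibre is a tree. -/
def IsArboretum (A : BorelGraphField R V E) : Prop :=
  ∀ x, (A.fiber x).IsTree

end BorelGraphField

/-- An element of the full pseudogroup `[[R]]`: a Borel isomorphism between Borel subsets
`source` and `target` of `X` whose graph is contained in `R`. -/
structure FullPseudogroup (R : BorelEqRel X) where
  toPartialEquiv : PartialEquiv X X
  measurableSet_source : MeasurableSet toPartialEquiv.source
  measurableSet_target : MeasurableSet toPartialEquiv.target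
  measurable_toFun : Measurable fun x : toPartialEquiv.source => toPartialEquiv x
  measurable_invFun : Measurable fun y : toPartialEquiv.target => toPartialEquiv.symm y
  rel : ∀ x ∈ toPartialEquiv.source, R.toSetoid (toPartialEquiv x) x

namespace FullPseudogroup

variable {R : BorelEqRel X} (φ : FullPseudogroup R)

/-- The domain of `φ`. -/
abbrev source : Set X := φ.toPartialEquiv.source

/-- The image of `φ`. -/
abbrev target : Set X := φ.toPartialEquiv.target

/-- For a relation `S` on the domain of `φ`, the relation `φ S φ⁻¹` on the image of `φ`. -/
def conj (S : φ.source → φ.source → Prop) (y y' : φ.target) : Prop :=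
  S ⟨φ.toPartialEquiv.symm y, φ.toPartialEquiv.map_target y.2⟩
    ⟨φ.toPartialEquiv.symm y', φ.toPartialEquiv.map_target y'.2⟩

end FullPseudogroup

end Actions

/-! ### Graphs of relations -/

/-- A graph of relations: a countable graph, a Borel equivalence relation on a standard Borel space
for each vertex and each edge, the same for an edge and its opposite, and for each edge `a` an
injective morphism from the relation carried by `a` to the relation carried by `ter a`. -/
structure GraphOfRelations where
  Vert : Type
  Edge : Type
  [countable_vert : Countable Vert]
  [countable_edge : Countable Edge]
  graph : SerreGraph Vert Edge
  vRel : Vert → BorelRelSpace.{u}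
  eRel : Edge → BorelRelSpace.{u}
  eRel_inv : ∀ a, eRel (graph.inv a) = eRel a
  mor : ∀ a, (eRel a).carrier → (vRel (graph.ter a)).carrier
  measurable_mor : ∀ a, Measurable (mor a)
  injective_mor : ∀ a, Function.Injective (mor a)
  mor_rel : ∀ a e e', (eRel a).rel.toSetoid e e' →
    (vRel (graph.ter a)).rel.toSetoid (mor a e) (mor a e')

namespace GraphOfRelations

variable (G : GraphOfRelations.{u})

/-- The disjoint union of the Borel spaces carried by the vertices. -/
abbrev TotV : Type u := Σ P : G.Vert, (G.vRel P).carrier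

/-- The disjoint union of the Borel spaces carried by the edges. -/
abbrev TotE : Type u := Σ a : G.Edge, (G.eRel a).carrier

/-- A point `e` of the space of `a`, seen in the (equal) space of the opposite of `a`. -/
def flip (e : G.TotE) : G.TotE :=
  ⟨G.graph.inv e.1, cast (congrArg BorelRelSpace.carrier (G.eRel_inv e.1).symm) e.2⟩

/-- The image of a point of the space of `a` by the injective morphism attached to `a`; it lies in
the space of the terminus of `a`. -/
def ter (e : G.TotE) : G.TotV := ⟨G.graph.ter e.1, G.mor e.1 e.2⟩

/-- The image of a point of the space of `a` by the injective morphism attached to the opposite of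
`a`; it lies in the space of the origin of `a`. -/
def org (e : G.TotE) : G.TotV := G.ter (G.flip e)

/-- Being joined by the partial isomorphism `org e ↦ ter e` carried by an edge of `T`. -/
def Step (T : Set G.Edge) (p q : G.TotV) : Prop :=
  ∃ e : G.TotE, e.1 ∈ T ∧ G.org e = p ∧ G.ter e = q

/-- A rooted maximal subtree: a subtree containing all vertices, and a vertex
(the root) such that the space it carries is a fundamental domain of the equivalence relation
generated, on the disjoint union of the vertex spaces, by the partial isomorphisms carried by the
edges of the subtree. -/
structure RootedMaximalTree where
  edges : Set G.Edge
  inv_mem : ∀ a ∈ edges, G.graph.inv a ∈ edges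
  isTree : (G.graph.restrictEdges edges inv_mem).IsTree
  root : G.Vert
  root_fundamental : ∀ p : G.TotV,
    ∃! y : (G.vRel root).carrier, Relation.EqvGen (G.Step edges) ⟨root, y⟩ p

end GraphOfRelations

/-! ### Representations and desingularizations -/

section Desingularizations

variable {X : Type u} [MeasurableSpace X] {R : BorelEqRel X}
  {V : Type v} {E : Type w} [MeasurableSpace V] [MeasurableSpace E]

/-- A representation in `A` of the rooted tree of relations induced by `G` on `T`. The rooted tree
defines an arboretum over the space `Y` of its root: its vertices are the points of the vertex
spaces, each lying over the point of `Y` in its class, and its edges are the points of the spaces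
of the edges of `T`. A representation is an isomorphism `base` of `Y` with a Borel
subset of `X` and an injective morphism of fields of graphs (`onV`, `onE`) over `base`
from this arboretum to `A`, identifying the carried relations with the restrictions of the orbit
relations. -/
structure TreeRepresentation {G : GraphOfRelations.{u}} (T : G.RootedMaximalTree)
    (A : BorelGraphField R V E) where
  base : (G.vRel T.root).carrier → X
  base_embedding : MeasurableEmbedding base
  onV : G.TotV → V
  onE : {e : G.TotE // e.1 ∈ T.edges} → E
  measurable_onV : Measurable onV
  measurable_onE : Measurable onE
  injective_onV : Function.Injective onV
  injective_onE : Function.Injective onE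
  proj_onV : ∀ y p, Relation.EqvGen (G.Step T.edges) ⟨T.root, y⟩ p → A.vert.proj (onV p) = base y
  org_onE : ∀ e, A.graph.org (onE e) = onV (G.org e.1)
  ter_onE : ∀ e, A.graph.ter (onE e) = onV (G.ter e.1)
  inv_onE : ∀ e, A.graph.inv (onE e) = onE ⟨G.flip e.1, T.inv_mem e.1.1 e.2⟩
  vRel_iff : ∀ P p q, (G.vRel P).rel.toSetoid p q ↔ A.vert.OrbitRel (onV ⟨P, p⟩) (onV ⟨P, q⟩)
  eRel_iff : ∀ a (ha : a ∈ T.edges) e e', (G.eRel a).rel.toSetoid e e' ↔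
    A.edge.OrbitRel (onE ⟨⟨a, e⟩, ha⟩) (onE ⟨⟨a, e'⟩, ha⟩)

namespace TreeRepresentation

variable {G : GraphOfRelations.{u}} {T : G.RootedMaximalTree} {A : BorelGraphField R V E}
  (χ : TreeRepresentation T A)

/-- The representation in `A` of the space carried by the vertex `P`. -/
def vertRep (P : G.Vert) : Set V := Set.range fun p : (G.vRel P).carrier => χ.onV ⟨P, p⟩

/-- The representation in `A` of the space carried by the edge `a` of the tree. -/
def edgeRep (a : T.edges) : Set E :=
  Set.range fun e : (G.eRel a).carrier => χ.onE ⟨⟨a, e⟩, a.2⟩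

/-- The identification, through `χ`, of the points of the vertex spaces with points of `X`. -/
def toBase (p : G.TotV) : X := A.vert.proj (χ.onV p)

/-- `G`, `T` and `χ` form an arboretum of representatives: the saturations of the representations
of the vertex spaces form a partition of the vertex space of `A`. -/
def IsArboretumOfRepresentatives : Prop :=
  IsPartitionFamily fun P : G.Vert => A.vert.saturation (χ.vertRep P)

end TreeRepresentation

/-- `f` induces an isomorphism from (the image under an injective map of) the relation carried by
`C` onto the relation `S` on the subset `D` of `X`. -/
def InducesIso (C : BorelRelSpace.{u}) (f : C.carrier → X) (D : Set X) (S : D → D → Prop) : Prop :=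
  Function.Injective f ∧ Set.range f = D ∧
  ∀ e e' (h : f e ∈ D) (h' : f e' ∈ D), C.rel.toSetoid e e' ↔ S ⟨f e, h⟩ ⟨f e', h'⟩

/-- A desingularization of the action of `R` on `A`. -/
structure Desingularization (A : BorelGraphField R V E) where
  G : GraphOfRelations.{u}
  /-- the orientation of the graph underlying `G` -/
  orientation : Set G.Edge
  orientation_iff : ∀ a, a ∈ orientation ↔ G.graph.inv a ∉ orientation
  T : G.RootedMaximalTree
  χ : TreeRepresentation T A
  representatives : χ.IsArboretumOfRepresentatives
  /-- the space carried by the root is identified with `X` -/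
  base_surjective : Function.Surjective χ.base
  /-- the partial isomorphisms carried by the oriented edges outside the tree -/
  φ : {a : G.Edge // a ∈ orientation ∧ a ∉ T.edges} → FullPseudogroup R
  /-- the partial sections of edges of `A` -/
  s : ∀ a, (φ a).source → E
  measurable_s : ∀ a, Measurable (s a)
  proj_s : ∀ a x, A.edge.proj (s a x) = x
  org_s : ∀ a x, A.graph.org (s a x) ∈ χ.vertRep (G.graph.org a.1)
  ter_s : ∀ a (x : (φ a).source),
    ∃ h : R.toSetoid ((φ a).toPartialEquiv x) (A.vert.proj (A.graph.ter (s a x))),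
      A.vert.act ((φ a).toPartialEquiv x) (A.graph.ter (s a x)) h ∈ χ.vertRep (G.graph.ter a.1)
  iso_org : ∀ a, InducesIso (G.eRel a.1) (fun e => χ.toBase (G.org ⟨a.1, e⟩)) (φ a).source
    (fun x y => A.edge.OrbitRel (s a x) (s a y))
  iso_ter : ∀ a, InducesIso (G.eRel a.1) (fun e => χ.toBase (G.ter ⟨a.1, e⟩)) (φ a).target
    ((φ a).conj fun x y => A.edge.OrbitRel (s a x) (s a y))
  /-- the two identifications of the space of `a` correspond to each other under `φ a` -/
  φ_org : ∀ a e, (φ a).toPartialEquiv (χ.toBase (G.org ⟨a.1, e⟩)) = χ.toBase (G.ter ⟨a.1, e⟩)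
  /-- the represented edges are the edges of the tree (in both directions) and the oriented edges
  outside the tree -/
  edge_partition : IsPartitionFamily
    (Sum.elim (fun a : T.edges => A.edge.saturation (χ.edgeRep a))
      (fun a => A.edge.saturation (Set.range (s a))))

end Desingularizations

/-! This is Bass–Serre theory with Borel partial sections in the role of vertices and edges. The
vertex and edge spaces have countable fibres over `X`, so the Lusin–Novikov theorem cuts them into
countably many Borel pieces on which the projection is injective. It also makes countable-to-one
images, hence saturations, Borel. Every choice can then be made by taking the first admissible index
in an enumeration.

The maximal subtree is lifted directly in `exists_treeOfSections`. Starting from a section over all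
of `X`, one keeps attaching pieces of edges whose origins lie on a section already built and whose
termini lie in orbits not yet met. Connectedness of the fibres forces every orbit of vertices to
meet one section, and by construction it meets only one. It may meet that section in many points;
this recurrence is the relation carried by the vertex of the quotient graph.

An edge outside the orbits of the tree can be translated so that its origin lies on a section, but
its terminus is then only equivalent to a point of a section. In `exists_complementarySections` the
pairs (edge, such a point) are cut into pieces on which both base points determine the pair. Sending
the first base point to the second is the required element of `[[R]]`; removing the orbits of edges
represented earlier makes the pieces disjoint up to translation.

The quotient graph has these sections as its vertices and edges. Its maximal subtree is given by the
parent function, which lowers indices, and all relations are pulled back from the orbit relations,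
so the remaining conditions are incidence checks. -/

/-! ### The Lusin–Novikov theorem. -/

open Set Filter Topology MeasureTheory in
/-- An analytic set on which a continuous map is injective is contained in a Borel set on which it
is injective. -/
theorem exists_measurableSet_superset_injOn {A : Type u} {X : Type v} [TopologicalSpace A]
    [PolishSpace A] [MeasurableSpace A] [BorelSpace A] [TopologicalSpace X] [T2Space X]
    [MeasurableSpace X] [BorelSpace X] {f : A → X} (hf : Continuous f) {S : Set A}
    (hS : AnalyticSet S) (hinj : InjOn f S) :
    ∃ C, S ⊆ C ∧ MeasurableSet C ∧ InjOn f C := by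
  -- Injectivity on `S` makes these analytic images disjoint, so Lusin separation puts a Borel set
  -- `D` between them. Discarding the points of `U` sent outside `D` and the points of `W` sent into
  -- `D` leaves no two points, one in each, with the same image. Countably many pairs `(U, W)`
  -- separate all points.
  have hsep : ∀ U ∈ TopologicalSpace.countableBasis A, ∀ W ∈ TopologicalSpace.countableBasis A,
      Disjoint U W → MeasurablySeparable (f '' (S ∩ U)) (f '' (S ∩ W)) := by
    intro U hU W hW hUW
    have han : ∀ O ∈ TopologicalSpace.countableBasis A, AnalyticSet (f '' (S ∩ O)) := by
      intro O hO
      rw [inter_eq_iInter]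
      refine (AnalyticSet.iInter fun b => ?_).image_of_continuous hf
      cases b
      · exact (TopologicalSpace.isOpen_of_mem_countableBasis hO).measurableSet.analyticSet
      · exact hS
    refine (han U hU).measurablySeparable (han W hW) ?_
    rw [disjoint_left]
    rintro _ ⟨a, ⟨haS, haU⟩, rfl⟩ ⟨b, ⟨hbS, hbW⟩, hab⟩
    have : b = a := hinj hbS haS hab
    exact disjoint_left.1 hUW haU (this ▸ hbW)
  choose! D hDU hDW hDm using hsep
  set I : Set (Set A × Set A) :=
    {q | q.1 ∈ TopologicalSpace.countableBasis A ∧ q.2 ∈ TopologicalSpace.countableBasis A ∧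
      Disjoint q.1 q.2} with hI
  have hIc : I.Countable :=
    ((TopologicalSpace.countable_countableBasis A).prod
      (TopologicalSpace.countable_countableBasis A)).mono fun q (hq : _ ∧ _ ∧ _) =>
        mem_prod.2 ⟨hq.1, hq.2.1⟩
  refine ⟨⋂ q ∈ I, ((q.1ᶜ ∪ f ⁻¹' D q.1 q.2) ∩ (q.2ᶜ ∪ (f ⁻¹' D q.1 q.2)ᶜ)), ?_, ?_, ?_⟩
  · intro a ha
    simp only [mem_iInter]
    rintro ⟨U, W⟩ ⟨hU, hW, hUW⟩
    refine ⟨?_, ?_⟩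
    · by_cases haU : a ∈ U
      · exact Or.inr (hDU U hU W hW hUW ⟨a, ⟨ha, haU⟩, rfl⟩)
      · exact Or.inl haU
    · by_cases haW : a ∈ W
      · exact Or.inr fun h => disjoint_left.1 (hDW U hU W hW hUW)
          (mem_image_of_mem f ⟨ha, haW⟩) h
      · exact Or.inl haW
  · refine MeasurableSet.biInter hIc ?_
    rintro ⟨U, W⟩ ⟨hU, hW, hUW⟩
    have h1 := (TopologicalSpace.isOpen_of_mem_countableBasis hU).measurableSet
    have h2 := (TopologicalSpace.isOpen_of_mem_countableBasis hW).measurableSet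
    have h3 := hf.measurable (hDm U hU W hW hUW)
    exact (h1.compl.union h3).inter (h2.compl.union h3.compl)
  · intro a ha b hb hab
    by_contra hne
    obtain ⟨O, O', hO, hO', haO, hbO', hd⟩ := t2_separation hne
    have hB := TopologicalSpace.isBasis_countableBasis A
    obtain ⟨U, hU, haU, hUO⟩ := hB.exists_subset_of_mem_open haO hO
    obtain ⟨W, hW, hbW, hWO⟩ := hB.exists_subset_of_mem_open hbO' hO'
    have hq : (U, W) ∈ I := ⟨hU, hW, hd.mono hUO hWO⟩
    have ha' := (mem_iInter₂.1 ha _ hq).1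
    have hb' := (mem_iInter₂.1 hb _ hq).2
    rcases ha' with h | h
    · exact h haU
    rcases hb' with h' | h'
    · exact h' hbW
    · exact h' (by simpa [mem_preimage, ← hab] using h)

/-- `n + 1` points of `B` in the boxes `u 0, …, u n`, all in the same fibre of `f`. -/
def FiberConfig {A : Type u} {X : Type v} (f : A → X) (n : ℕ) (u : ℕ → Set A) (B : Set A) :
    Set (ℕ → A) :=
  {z | ∀ j ≤ n, z j ∈ u j ∩ B ∧ f (z j) = f (z 0)}

theorem fiberConfig_congr {A : Type u} {X : Type v} (f : A → X) {n : ℕ} {u u' : ℕ → Set A}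
    (h : ∀ j ≤ n, u j = u' j) (B : Set A) : FiberConfig f n u B = FiberConfig f n u' B := by
  ext z
  exact forall₂_congr fun j hj => by rw [h j hj]

theorem measurableSet_fiberConfig {A : Type u} {X : Type v} [MeasurableSpace A]
    [MeasurableSpace X] [StandardBorelSpace X] {f : A → X} (hf : Measurable f) (n : ℕ)
    {u : ℕ → Set A} (hu : ∀ j, MeasurableSet (u j)) {B : Set A} (hB : MeasurableSet B) :
    MeasurableSet (FiberConfig f n u B) := by
  have : FiberConfig f n u B = ⋂ j : ℕ, ⋂ _ : j ≤ n,
      ((fun z : ℕ → A => z j) ⁻¹' (u j ∩ B) ∩ {z | f (z j) = f (z 0)}) := by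
    ext z
    simp [FiberConfig]
  rw [this]
  refine MeasurableSet.iInter fun j => MeasurableSet.iInter fun _ => ?_
  exact ((measurable_pi_apply j) ((hu j).inter hB)).inter
    (measurableSet_eq_fun (hf.comp (measurable_pi_apply j)) (hf.comp (measurable_pi_apply 0)))

open Set in
/-- The σ-ideal of the sets covered by countably many Borel sets on which `f` is injective. -/
def SigmaInjective {A : Type u} {X : Type v} [MeasurableSpace A] (f : A → X) (S : Set A) : Prop :=
  ∃ C : ℕ → Set A, (∀ n, MeasurableSet (C n)) ∧ (∀ n, InjOn f (C n)) ∧ S ⊆ ⋃ n, C n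

open Set in
theorem SigmaInjective.iUnion {A : Type u} {X : Type v} [MeasurableSpace A] {f : A → X}
    {ι : Type*} [Countable ι] {S : ι → Set A} (h : ∀ i, SigmaInjective f (S i)) :
    SigmaInjective f (⋃ i, S i) := by
  choose C hm hi hs using h
  rcases isEmpty_or_nonempty ι with hι | hι
  · exact ⟨fun _ => ∅, fun _ => MeasurableSet.empty, fun _ => injOn_empty f, by simp⟩
  obtain ⟨e, he⟩ := exists_surjective_nat (ι × ℕ)
  refine ⟨fun n => C (e n).1 (e n).2, fun n => hm _ _, fun n => hi _ _, ?_⟩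
  refine iUnion_subset fun i a ha => ?_
  obtain ⟨m, hmem⟩ := mem_iUnion.1 (hs i ha)
  obtain ⟨k, hk⟩ := he (i, m)
  exact mem_iUnion.2 ⟨k, by rw [hk]; exact hmem⟩

theorem SigmaInjective.of_injOn {A : Type u} {X : Type v} [MeasurableSpace A] {f : A → X}
    {S : Set A} (hm : MeasurableSet S) (h : Set.InjOn f S) : SigmaInjective f S :=
  ⟨fun _ => S, fun _ => hm, fun _ => h, Set.subset_iUnion (fun _ : ℕ => S) 0⟩

open Set TopologicalSpace in
/-- If `f` is not a countable union of Borel injections, some Borel set `B` has the property that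
every configuration realized in `B` can be realized in `B` outside any set of the σ-ideal. -/
theorem exists_stable_of_not_sigmaInjective {A : Type u} {X : Type v} [TopologicalSpace A]
    [SecondCountableTopology A] [MeasurableSpace A] {f : A → X}
    (hno : ¬ SigmaInjective f (univ : Set A)) :
    ∃ B : Set A, MeasurableSet B ∧ B.Nonempty ∧ ∀ n (u : ℕ → Set A),
      (∀ j, u j ∈ countableBasis A) → (FiberConfig f n u B).Nonempty →
      ∀ C, MeasurableSet C → SigmaInjective f C → (FiberConfig f n u (B \ C)).Nonempty := by
  classical
  let K := Σ n : ℕ, (Fin (n + 1) → countableBasis A)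
  have : Countable (countableBasis A) := (countable_countableBasis A).to_subtype
  let ext : K → ℕ → Set A := fun p j => if h : j < p.1 + 1 then (p.2 ⟨j, h⟩ : Set A) else ∅
  -- A type of configuration is destroyed by `C` when no configuration of that type lies outside
  -- `C`. There are countably many types, so one destroying set for each destructible type can be
  -- removed while staying in the σ-ideal.
  let bad : K → Set A → Prop := fun p C =>
    MeasurableSet C ∧ SigmaInjective f C ∧ ¬ (FiberConfig f p.1 (ext p) Cᶜ).Nonempty
  have hch : ∀ p : K, ∃ C, MeasurableSet C ∧ SigmaInjective f C ∧ ((∃ C', bad p C') → bad p C) := by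
    intro p
    by_cases h : ∃ C', bad p C'
    · obtain ⟨C, hC⟩ := h
      exact ⟨C, hC.1, hC.2.1, fun _ => hC⟩
    · exact ⟨∅, MeasurableSet.empty, .of_injOn MeasurableSet.empty (injOn_empty f),
        fun h' => absurd h' h⟩
  choose C hCm hCs hCb using hch
  have hmono : ∀ n (u : ℕ → Set A) {B B' : Set A}, B ⊆ B' →
      (FiberConfig f n u B).Nonempty → (FiberConfig f n u B').Nonempty := by
    rintro n u B B' hBB ⟨z, hz⟩
    exact ⟨z, fun j hj => ⟨⟨(hz j hj).1.1, hBB (hz j hj).1.2⟩, (hz j hj).2⟩⟩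
  refine ⟨(⋃ p, C p)ᶜ, (MeasurableSet.iUnion hCm).compl, ?_, ?_⟩
  · rw [nonempty_compl]
    intro h
    exact hno (h ▸ SigmaInjective.iUnion hCs)
  · intro n u hu hne D hDm hDs
    by_contra hcon
    let p : K := ⟨n, fun j => ⟨u j, hu j⟩⟩
    have hpu : ∀ j ≤ n, u j = ext p j := by
      intro j hj
      simp only [ext, p, Nat.lt_succ_of_le hj, dif_pos]
    -- If `D` destroyed this type inside the remaining set, then `D` together with everything
    -- removed would destroy it outright. The set `C p` removed for this type would then already do
    -- so, against `hne`.
    have hbad : bad p ((⋃ p, C p) ∪ D) := by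
      refine ⟨(MeasurableSet.iUnion hCm).union hDm, ?_, ?_⟩
      · rw [union_eq_iUnion]
        refine SigmaInjective.iUnion fun b => ?_
        cases b
        · exact hDs
        · exact SigmaInjective.iUnion hCs
      · rw [← fiberConfig_congr f hpu, compl_union]
        exact hcon
    refine (hCb p ⟨_, hbad⟩).2.2 ?_
    rw [← fiberConfig_congr f hpu]
    exact hmono n u (compl_subset_compl.2 (subset_iUnion C p)) hne

open Set Filter Topology MeasureTheory TopologicalSpace in
-- If no point could be split, the `i`-th coordinates of configurations would form an analytic set
-- on which `f` is injective. A Borel injective superset belongs to the σ-ideal, yet a configuration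
-- avoiding it still has its `i`-th coordinate in it.
theorem exists_split_of_stable {A : Type u} {X : Type v} [TopologicalSpace A]
    [PolishSpace A] [MeasurableSpace A] [BorelSpace A] [TopologicalSpace X] [PolishSpace X]
    [MeasurableSpace X] [BorelSpace X] {f : A → X} (hf : Continuous f) {B : Set A}
    (hB : MeasurableSet B) {n : ℕ} {u : ℕ → Set A} (hu : ∀ j, u j ∈ countableBasis A)
    (h : ∀ C, MeasurableSet C → SigmaInjective f C → (FiberConfig f n u (B \ C)).Nonempty)
    {i : ℕ} (hi : i ≤ n) :
    ∃ z ∈ FiberConfig f n u B, ∃ y ∈ u i ∩ B, y ≠ z i ∧ f y = f (z i) := by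
  by_contra! hcon
  have hm := measurableSet_fiberConfig hf.measurable n
    (fun j => (isOpen_of_mem_countableBasis (hu j)).measurableSet) hB
  have hS : AnalyticSet ((fun z : ℕ → A => z i) '' FiberConfig f n u B) :=
    hm.analyticSet_image (measurable_pi_apply i)
  obtain ⟨C, hSC, hCm, hCi⟩ := exists_measurableSet_superset_injOn hf hS (by
    rintro _ ⟨z, hz, rfl⟩ _ ⟨z', hz', rfl⟩ hzz
    by_contra hne
    exact hcon z' hz' (z i) (hz i hi).1 hne hzz)
  obtain ⟨z, hz⟩ := h C hCm (.of_injOn hCm hCi)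
  exact (hz i hi).1.2.2 (hSC ⟨z, fun j hj => ⟨⟨(hz j hj).1.1, (hz j hj).1.2.1⟩, (hz j hj).2⟩, rfl⟩)

open Set Filter Topology MeasureTheory TopologicalSpace in
-- Otherwise repeated splitting inside a stable set `B` gives a scheme of shrinking boxes that
-- always contain configurations in a common fibre. In the limit one fibre contains a nonempty
-- perfect set, which is uncountable.
theorem sigmaInjective_univ_of_continuous {A : Type u} {X : Type v} [TopologicalSpace A]
    [PolishSpace A] [MeasurableSpace A] [BorelSpace A] [TopologicalSpace X] [PolishSpace X]
    [MeasurableSpace X] [BorelSpace X] {f : A → X} (hf : Continuous f)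
    (hc : ∀ x, (f ⁻¹' {x}).Countable) : SigmaInjective f (univ : Set A) := by
  by_contra hno
  let _ := upgradeIsCompletelyMetrizable A
  obtain ⟨B, hBm, ⟨b, hb⟩, hB⟩ := exists_stable_of_not_sigmaInjective hno
  let P : ℕ → (ℕ → Set A) → Prop := fun n u =>
    (∀ j, u j ∈ countableBasis A) ∧ (FiberConfig f n u B).Nonempty
  have hbasis := isBasis_countableBasis A
  have hsmall : ∀ (a : A) (O : Set A), O ∈ 𝓝 a → ∀ ε > 0, ∃ U ∈ countableBasis A, a ∈ U ∧
      closure U ⊆ O ∧ ∀ x ∈ closure U, ∀ y ∈ closure U, dist x y ≤ ε := by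
    intro a O hO ε hε
    obtain ⟨U, hU, haU, hUO⟩ := hbasis.exists_closure_subset
      (inter_mem hO (Metric.ball_mem_nhds a (half_pos hε)))
    refine ⟨U, hU, haU, fun x hx => (hUO hx).1, fun x hx y hy => ?_⟩
    have h1 := Metric.mem_ball.1 (hUO hx).2
    have h2 := Metric.mem_ball.1 (hUO hy).2
    linarith [dist_triangle_right x y a]
  -- Stage `n` has the points `0, …, n`. Point `(Nat.unpair n).1` is split, the new point receives
  -- the number `n + 1`, and all boxes shrink. Unpairing returns to each index infinitely often.
  have hstep : ∀ n u, P n u → ∃ u', P (n + 1) u' ∧ (∀ j ≤ n, closure (u' j) ⊆ u j) ∧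
      closure (u' (n + 1)) ⊆ u (Nat.unpair n).1 ∧
      Disjoint (closure (u' (n + 1))) (closure (u' (Nat.unpair n).1)) ∧
      ∀ j ≤ n + 1, ∀ x ∈ closure (u' j), ∀ y ∈ closure (u' j), dist x y ≤ (1 / 2 : ℝ) ^ n := by
    rintro n u ⟨hu, hne⟩
    have hi : (Nat.unpair n).1 ≤ n := Nat.unpair_left_le n
    set i := (Nat.unpair n).1
    obtain ⟨z, hz, y, hy, hyz, hfy⟩ := exists_split_of_stable hf hBm hu (hB n u hu hne) hi
    obtain ⟨O, hyO, hO, O', hzO', hO', hd⟩ := exists_open_nhds_disjoint_closure hyz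
    have hε : (0 : ℝ) < (1 / 2) ^ n := by positivity
    have hch : ∀ j, ∃ U ∈ countableBasis A, j ≤ n → (z j ∈ U ∧ closure U ⊆ u j ∧
        (j = i → closure U ⊆ O') ∧
        ∀ x ∈ closure U, ∀ y ∈ closure U, dist x y ≤ (1 / 2 : ℝ) ^ n) := by
      intro j
      by_cases hj : j ≤ n
      · have hn : u j ∩ (if j = i then O' else univ) ∈ 𝓝 (z j) := by
          refine inter_mem ((isOpen_of_mem_countableBasis (hu j)).mem_nhds (hz j hj).1.1) ?_
          split_ifs with h
          · subst h; exact hO'.mem_nhds hzO'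
          · exact univ_mem
        obtain ⟨U, hU, h1, h2, h3⟩ := hsmall _ _ hn _ hε
        refine ⟨U, hU, fun _ => ⟨h1, fun x hx => (h2 hx).1, fun h x hx => ?_, h3⟩⟩
        simpa [h] using (h2 hx).2
      · exact ⟨u j, hu j, fun h => absurd h hj⟩
    choose U hU hU' using hch
    obtain ⟨W, hW, hyW, hWs, hWd⟩ := hsmall y (u i ∩ O)
      (inter_mem ((isOpen_of_mem_countableBasis (hu i)).mem_nhds hy.1) (hO.mem_nhds hyO)) _ hε
    have hin : i ≠ n + 1 := by omega
    have hold : ∀ j ≤ n, (Function.update U (n + 1) W) j = U j := fun j hj =>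
      Function.update_of_ne (by omega) _ _
    refine ⟨Function.update U (n + 1) W, ⟨?_, Function.update z (n + 1) y, ?_⟩, ?_, ?_, ?_, ?_⟩
    · intro j
      by_cases hj : j = n + 1
      · subst hj; simpa using hW
      · simpa [Function.update_of_ne hj] using hU j
    · intro j hj
      have h0 : Function.update z (n + 1) y 0 = z 0 := Function.update_of_ne (by omega) _ _
      rw [h0]
      rcases Nat.le_succ_iff.1 hj with hj' | rfl
      · have hjn : j ≠ n + 1 := by omega
        have hzj : Function.update z (n + 1) y j = z j := Function.update_of_ne hjn _ _
        rw [hzj, hold j hj']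
        exact ⟨⟨(hU' j hj').1, (hz j hj').1.2⟩, (hz j hj').2⟩
      · simp only [Nat.succ_eq_add_one, Function.update_self]
        exact ⟨⟨hyW, hy.2⟩, hfy.trans (hz i hi).2⟩
    · intro j hj
      rw [hold j hj]
      exact (hU' j hj).2.1
    · rw [Function.update_self]
      exact fun x hx => (hWs hx).1
    · rw [Function.update_self, hold i hi]
      exact (hd.mono subset_closure subset_closure).mono (fun x hx => (hWs hx).2)
        ((hU' i hi).2.2.1 rfl)
    · intro j hj
      rcases Nat.le_succ_iff.1 hj with hj' | rfl
      · rw [hold j hj']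
        exact (hU' j hj').2.2.2
      · simpa using hWd
  obtain ⟨U₀, hU₀, hbU₀, -⟩ := hbasis.exists_subset_of_mem_open (mem_univ b) isOpen_univ
  have h0 : P 0 fun _ => U₀ := ⟨fun _ => hU₀, fun _ => b, fun j _ => ⟨⟨hbU₀, hb⟩, rfl⟩⟩
  choose next hnext h1 h2 h3 h4 using hstep
  let s : ∀ n, {u : ℕ → Set A // P n u} := fun n =>
    Nat.rec ⟨_, h0⟩ (fun n u => ⟨next n u.1 u.2, hnext n u.1 u.2⟩) n
  have hs1 : ∀ n, ∀ j ≤ n, closure ((s (n + 1)).1 j) ⊆ (s n).1 j := fun n => h1 n _ (s n).2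
  have hs2 : ∀ n, closure ((s (n + 1)).1 (n + 1)) ⊆ (s n).1 (Nat.unpair n).1 :=
    fun n => h2 n _ (s n).2
  have hs3 : ∀ n, Disjoint (closure ((s (n + 1)).1 (n + 1)))
      (closure ((s (n + 1)).1 (Nat.unpair n).1)) := fun n => h3 n _ (s n).2
  have hs4 : ∀ n, ∀ j ≤ n + 1, ∀ x ∈ closure ((s (n + 1)).1 j), ∀ y ∈ closure ((s (n + 1)).1 j),
      dist x y ≤ (1 / 2 : ℝ) ^ n := fun n => h4 n _ (s n).2
  have hanti : ∀ j n m, j ≤ n → n ≤ m → (s m).1 j ⊆ (s n).1 j := by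
    intro j n m hjn hnm
    induction m, hnm using Nat.le_induction with
    | base => exact Subset.rfl
    | succ m hm ih => exact (subset_closure.trans (hs1 m j (hjn.trans hm))).trans ih
  choose z hz using fun n => (s n).2.2
  have hpow : Tendsto (fun n : ℕ => (1 / 2 : ℝ) ^ n) atTop (𝓝 0) :=
    tendsto_pow_atTop_nhds_zero_of_lt_one (by norm_num) (by norm_num)
  have hlim : ∀ j, ∃ a, Tendsto (fun n => z n j) atTop (𝓝 a) := by
    intro j
    suffices h : CauchySeq fun n => z (n + (j + 1)) j by
      obtain ⟨a, ha⟩ := cauchySeq_tendsto_of_complete h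
      exact ⟨a, (tendsto_add_atTop_iff_nat (j + 1)).1 ha⟩
    refine cauchySeq_of_le_tendsto_0 _ (fun n m N hn hm => ?_) hpow
    have hmem : ∀ k, N ≤ k → z (k + (j + 1)) j ∈ (s (N + j + 1)).1 j := fun k hk =>
      hanti j (N + j + 1) (k + (j + 1)) (by omega) (by omega) (hz (k + (j + 1)) j (by omega)).1.1
    refine (hs4 (N + j) j (by omega) _ (subset_closure (hmem n hn)) _
      (subset_closure (hmem m hm))).trans ?_
    exact pow_le_pow_of_le_one (by norm_num) (by norm_num) (by omega)
  -- The configurations of successive stages are unrelated, so convergence comes from the nested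
  -- boxes alone. The limits may leave `B`, which is harmless: continuity keeps them in one fibre of
  -- `f`.
  choose a ha using hlim
  have hacl : ∀ j n, j ≤ n → a j ∈ closure ((s n).1 j) := by
    intro j n hjn
    refine mem_closure_of_tendsto (ha j) ?_
    filter_upwards [eventually_ge_atTop n] with m hm
    exact hanti j n m hjn hm (hz m j (hjn.trans hm)).1.1
  have hfa : ∀ j, f (a j) = f (a 0) := by
    intro j
    refine tendsto_nhds_unique ((hf.tendsto _).comp (ha j))
      (((hf.tendsto _).comp (ha 0)).congr' ?_)
    filter_upwards [eventually_ge_atTop j] with m hm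
    exact ((hz m j hm).2).symm
  have hpre : Preperfect (range a) := by
    rw [preperfect_iff_nhds]
    rintro _ ⟨i, rfl⟩ O hO
    obtain ⟨ε, hε, hεO⟩ := Metric.mem_nhds_iff.1 hO
    obtain ⟨N, hN⟩ := ((hpow.eventually (gt_mem_nhds hε)).and (eventually_ge_atTop i)).exists
    -- Stage `n` splits point `i`. Taking `N + 1` rather than `N` ensures `n = k + 1` with `k ≥ N`,
    -- so the boxes of stage `n` already have diameter at most `(1 / 2) ^ N`.
    set n := Nat.pair i (N + 1) with hn
    have hiN : N + 1 ≤ n := Nat.right_le_pair _ _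
    have hni : (Nat.unpair n).1 = i := by rw [hn, Nat.unpair_pair]
    refine ⟨a (n + 1), ⟨hεO ?_, mem_range_self _⟩, fun h => ?_⟩
    · have e1 : a (n + 1) ∈ closure ((s n).1 i) := by
        have := hs2 n (hacl (n + 1) (n + 1) le_rfl)
        rw [hni] at this
        exact subset_closure this
      have e2 : a i ∈ closure ((s n).1 i) := hacl i n (by omega)
      obtain ⟨k, hk⟩ : ∃ k, n = k + 1 := ⟨n - 1, by omega⟩
      rw [hk] at e1 e2 ⊢
      rw [Metric.mem_ball]
      refine lt_of_le_of_lt (hs4 k i (by omega) _ e1 _ e2) (lt_of_le_of_lt ?_ hN.1)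
      exact pow_le_pow_of_le_one (by norm_num) (by norm_num) (by omega)
    · have := disjoint_left.1 (hs3 n) (hacl (n + 1) (n + 1) le_rfl)
      rw [hni, h] at this
      exact this (hacl i (n + 1) (by omega))
  obtain ⟨g, hg, -, hgi⟩ := hpre.perfect_closure.exists_nat_bool_injection
    ⟨a 0, subset_closure (mem_range_self 0)⟩
  have hcl : closure (range a) ⊆ f ⁻¹' {f (a 0)} := by
    refine closure_minimal ?_ (isClosed_singleton.preimage hf)
    rintro _ ⟨j, rfl⟩
    exact hfa j
  have hcount : (range g).Countable := (hc (f (a 0))).mono (hg.trans hcl)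
  have : (univ : Set (ℕ → Bool)).Countable := by
    rw [← image_univ] at hcount
    exact countable_of_injective_of_countable_image hgi.injOn hcount
  have hunc := Cardinal.mk_le_aleph0_iff.2 (countable_univ_iff.1 this)
  simp only [Cardinal.mk_pi, Cardinal.mk_bool, Cardinal.prod_const] at hunc
  simp at hunc
  exact absurd hunc (not_le.2 (Cardinal.cantor _))

open Set MeasureTheory in
/-- The **Lusin–Novikov theorem**: a Borel set on which a Borel map has countable fibres is a
countable union of Borel sets on which the map is injective. -/
theorem MeasurableSet.exists_iUnion_injOn_of_countable_fiber {A : Type u} {X : Type v}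
    [MeasurableSpace A] [StandardBorelSpace A] [MeasurableSpace X] [StandardBorelSpace X]
    {f : A → X} (hf : Measurable f) {S : Set A} (hS : MeasurableSet S)
    (hc : ∀ x, (S ∩ f ⁻¹' {x}).Countable) :
    ∃ C : ℕ → Set A, (∀ n, MeasurableSet (C n)) ∧ (∀ n, InjOn f (C n)) ∧ S = ⋃ n, C n := by
  let _ := upgradeStandardBorel X
  have : StandardBorelSpace S := hS.standardBorel
  let tS := upgradeStandardBorel S
  -- A finer Polish topology on `S` makes `f` continuous without changing the Borel sets.
  obtain ⟨t, ht, hft, hpol⟩ := (hf.comp measurable_subtype_coe : Measurable fun a : S => f a)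
    |>.exists_continuous
  have hbor : @BorelSpace S t _ :=
    ⟨by rw [borel_eq_borel_of_le hpol tS.toPolishSpace ht]; exact tS.toBorelSpace.measurable_eq⟩
  obtain ⟨C, h1, h2, h3⟩ := @sigmaInjective_univ_of_continuous S X t hpol _ hbor _ _ _ _ _ hft
    (fun x => by
      refine countable_of_injective_of_countable_image (f := Subtype.val)
        Subtype.val_injective.injOn ((hc x).mono ?_)
      rintro _ ⟨a, ha, rfl⟩
      exact ⟨a.2, ha⟩)
  refine ⟨fun n => Subtype.val '' C n, fun n => hS.subtype_image (h1 n), fun n => ?_, ?_⟩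
  · rintro _ ⟨a, ha, rfl⟩ _ ⟨b, hb, rfl⟩ hab
    exact congrArg _ (h2 n ha hb hab)
  · ext a
    simp only [mem_iUnion, mem_image]
    constructor
    · intro ha
      obtain ⟨n, hn⟩ := mem_iUnion.1 (h3 (mem_univ (⟨a, ha⟩ : S)))
      exact ⟨n, _, hn, rfl⟩
    · rintro ⟨n, b, -, rfl⟩
      exact b.2

open Set MeasureTheory in
-- The set is a countable union of pieces on which `f` is injective, and injective Borel images of
-- Borel sets are Borel.
theorem MeasurableSet.image_of_countable_fiber {A : Type u} {X : Type v}
    [MeasurableSpace A] [StandardBorelSpace A] [MeasurableSpace X] [StandardBorelSpace X]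
    {f : A → X} (hf : Measurable f) {S : Set A} (hS : MeasurableSet S)
    (hc : ∀ x, (S ∩ f ⁻¹' {x}).Countable) : MeasurableSet (f '' S) := by
  obtain ⟨C, hm, hi, rfl⟩ := hS.exists_iUnion_injOn_of_countable_fiber hf hc
  rw [image_iUnion]
  exact MeasurableSet.iUnion fun n => (hm n).image_of_measurable_injOn hf (hi n)

/-- The inverse of an injective Borel map on a Borel set is a Borel section. -/
theorem exists_measurable_section_of_injOn {A : Type u} {X : Type v}
    [MeasurableSpace A] [StandardBorelSpace A] [MeasurableSpace X] [StandardBorelSpace X]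
    {f : A → X} (hf : Measurable f) {S : Set A} (hS : MeasurableSet S) (hi : Set.InjOn f S) :
    ∃ σ : f '' S → A, Measurable σ ∧ ∀ x, σ x ∈ S ∧ f (σ x) = x := by
  choose σ hσ using fun x : f '' S => x.2
  refine ⟨σ, fun T hT => ?_, hσ⟩
  have : σ ⁻¹' T = Subtype.val ⁻¹' (f '' (S ∩ T)) := by
    ext x
    refine ⟨fun h => ⟨σ x, ⟨(hσ x).1, h⟩, (hσ x).2⟩, ?_⟩
    rintro ⟨a, ⟨haS, haT⟩, hax⟩
    have : σ x = a := hi (hσ x).1 haS ((hσ x).2.trans hax.symm)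
    rwa [Set.mem_preimage, this]
  rw [this]
  exact measurable_subtype_coe
    ((hS.inter hT).image_of_measurable_injOn hf (hi.mono Set.inter_subset_left))

/-! ### Saturations, orbit relations and partial isomorphisms. -/

namespace BorelEqRel

variable {F : Type u} [MeasurableSpace F]

/-- The saturation of a set. -/
def saturate (Q : BorelEqRel F) (S : Set F) : Set F := {f | ∃ f' ∈ S, Q.toSetoid f f'}

/-- The saturation is the first projection of a Borel part of the graph, and the fibres of that
projection are contained in copies of the classes, which are countable. -/
theorem measurableSet_saturate [StandardBorelSpace F] (Q : BorelEqRel F) {S : Set F}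
    (hS : MeasurableSet S) : MeasurableSet (Q.saturate S) := by
  have h : Q.saturate S = Prod.fst '' ({p : F × F | Q.toSetoid p.1 p.2} ∩ Prod.snd ⁻¹' S) := by
    ext f
    constructor
    · rintro ⟨f', hf', h⟩
      exact ⟨(f, f'), ⟨h, hf'⟩, rfl⟩
    · rintro ⟨⟨f, f'⟩, ⟨h, hf'⟩, rfl⟩
      exact ⟨f', hf', h⟩
  rw [h]
  refine (Q.measurableSet_graph.inter (measurable_snd hS)).image_of_countable_fiber
    measurable_fst fun x => ?_
  refine ((Q.countable_class x).image (Prod.mk x)).mono ?_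
  rintro ⟨f, f'⟩ ⟨⟨h, -⟩, rfl⟩
  exact ⟨f', h, rfl⟩

/-- The relation induced by an injective Borel map. -/
def comap (Q : BorelEqRel F) {Y : Type v} [MeasurableSpace Y] (σ : Y → F) (hσ : Measurable σ)
    (hi : Function.Injective σ) : BorelEqRel Y where
  toSetoid := Q.toSetoid.comap σ
  measurableSet_graph := (hσ.prodMap hσ) Q.measurableSet_graph
  countable_class y := (Q.countable_class (σ y)).preimage hi

end BorelEqRel

namespace FiberedAction

variable {X : Type u} [MeasurableSpace X] {R : BorelEqRel X} {F : Type v} [MeasurableSpace F]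
  {F' : Type w} [MeasurableSpace F'] (Φ : FiberedAction R F) {Φ' : FiberedAction R F'}

theorem act_congr {x x' : X} {t t' : F} (hx : x = x') (ht : t = t')
    (h : R.toSetoid x (Φ.proj t)) (h' : R.toSetoid x' (Φ.proj t')) :
    Φ.act x t h = Φ.act x' t' h' := by
  subst hx ht
  rfl

theorem orbitRel_act (x : X) (t : F) (h : R.toSetoid x (Φ.proj t)) :
    Φ.OrbitRel (Φ.act x t h) t :=
  ⟨(Φ.proj_act x t h).symm ▸ h, Φ.act_congr (Φ.proj_act x t h) rfl _ _⟩

theorem OrbitRel.refl (f : F) : Φ.OrbitRel f f := ⟨R.toSetoid.refl _, Φ.act_self f⟩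

variable {Φ}

theorem orbitRel_of_act_eq {x : X} {f f' : F} {h : R.toSetoid x (Φ.proj f')}
    (hf : Φ.act x f' h = f) : Φ.OrbitRel f f' :=
  hf ▸ Φ.orbitRel_act x f' h

theorem OrbitRel.symm {f f' : F} (h : Φ.OrbitRel f f') : Φ.OrbitRel f' f := by
  obtain ⟨h, hf⟩ := h
  have h' := R.toSetoid.symm h
  refine ⟨h', ?_⟩
  calc Φ.act (Φ.proj f') f h'
      = Φ.act (Φ.proj f') (Φ.act (Φ.proj f) f' h) ((Φ.proj_act _ _ h).symm ▸ h') :=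
        Φ.act_congr rfl hf.symm _ _
    _ = Φ.act (Φ.proj f') f' (R.toSetoid.refl _) := Φ.act_act _ _ f' h' h
    _ = f' := Φ.act_self f'

theorem OrbitRel.trans {f g k : F} (h : Φ.OrbitRel f g) (h' : Φ.OrbitRel g k) :
    Φ.OrbitRel f k := by
  obtain ⟨h, hf⟩ := h
  obtain ⟨h', hg⟩ := h'
  refine ⟨R.toSetoid.trans h h', ?_⟩
  calc Φ.act (Φ.proj f) k (R.toSetoid.trans h h')
      = Φ.act (Φ.proj f) (Φ.act (Φ.proj g) k h') ((Φ.proj_act _ _ h').symm ▸ h) :=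
        (Φ.act_act _ _ k h h').symm
    _ = Φ.act (Φ.proj f) g h := Φ.act_congr rfl hg _ _
    _ = f := hf

theorem OrbitRel.rel {f g : F} (h : Φ.OrbitRel f g) : R.toSetoid (Φ.proj f) (Φ.proj g) := h.1

theorem measurableSet_orbitRel [StandardBorelSpace F] :
    MeasurableSet {p : F × F | Φ.OrbitRel p.1 p.2} := by
  let D : Set (F × F) := {p | R.toSetoid (Φ.proj p.1) (Φ.proj p.2)}
  have hD : MeasurableSet D :=
    (Φ.measurable_proj.prodMap Φ.measurable_proj) R.measurableSet_graph
  have hm : Measurable fun p : D => Φ.act (Φ.proj p.1.1) p.1.2 p.2 :=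
    Φ.measurable_act.comp (g := fun q : {q : X × F // R.toSetoid q.1 (Φ.proj q.2)} =>
      Φ.act q.1.1 q.1.2 q.2) (f := fun p : D => ⟨(Φ.proj p.1.1, p.1.2), p.2⟩)
      (Measurable.subtype_mk
        ((Φ.measurable_proj.comp (measurable_fst.comp measurable_subtype_coe)).prodMk
          (measurable_snd.comp measurable_subtype_coe)))
  have h := hD.subtype_image
    (measurableSet_eq_fun hm (measurable_fst.comp measurable_subtype_coe))
  convert h using 1
  ext p
  constructor
  · rintro ⟨h, hp⟩
    exact ⟨⟨p, h⟩, hp, rfl⟩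
  · rintro ⟨⟨p, h⟩, hp, rfl⟩
    exact ⟨h, hp⟩

variable (Φ)

theorem countable_preimage_class (x : X) : {f | R.toSetoid x (Φ.proj f)}.Countable := by
  have : {f | R.toSetoid x (Φ.proj f)} = ⋃ y ∈ {y | R.toSetoid x y}, Φ.proj ⁻¹' {y} := by
    ext f
    simp
  rw [this]
  exact (R.countable_class x).biUnion fun y _ => Φ.countable_fiber y

/-- The orbit equivalence relation, as a Borel equivalence relation with countable classes. -/
def orbit [StandardBorelSpace F] : BorelEqRel F where
  toSetoid := ⟨Φ.OrbitRel, OrbitRel.refl Φ, OrbitRel.symm, OrbitRel.trans⟩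
  measurableSet_graph := measurableSet_orbitRel
  countable_class f := (Φ.countable_preimage_class (Φ.proj f)).mono fun _ h => OrbitRel.rel h

variable {Φ}

theorem IsMorphism.orbitRel {m : F → F'} (hm : Φ.IsMorphism Φ' m) {f g : F}
    (h : Φ.OrbitRel f g) : Φ'.OrbitRel (m f) (m g) := by
  obtain ⟨h, hf⟩ := h
  refine orbitRel_of_act_eq (x := Φ.proj f) (h := (hm.proj_map g).symm ▸ h) ?_
  rw [← hm.map_act _ _ h, hf]

/-- A point over the orbit of `m g` can be lifted to the orbit of `g`. -/
theorem IsMorphism.exists_lift {m : F → F'} (hm : Φ.IsMorphism Φ' m) {g : F} {y : F'}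
    (h : Φ'.OrbitRel y (m g)) : ∃ f, Φ.OrbitRel f g ∧ m f = y := by
  obtain ⟨h, hy⟩ := h
  have h' : R.toSetoid (Φ'.proj y) (Φ.proj g) := hm.proj_map g ▸ h
  exact ⟨Φ.act (Φ'.proj y) g h', Φ.orbitRel_act _ _ _, by rw [hm.map_act, hy]⟩

end FiberedAction

open Classical in
/-- A Borel set on which two `R`-related Borel maps to `X` are injective defines an element of the
full pseudogroup. -/
theorem exists_fullPseudogroup_of_injOn {X : Type u} [MeasurableSpace X] [StandardBorelSpace X]
    (R : BorelEqRel X) {Z : Type v} [MeasurableSpace Z] [StandardBorelSpace Z] {p q : Z → X}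
    (hp : Measurable p) (hq : Measurable q) {S : Set Z} (hS : MeasurableSet S)
    (hpS : Set.InjOn p S) (hqS : Set.InjOn q S) (hR : ∀ z ∈ S, R.toSetoid (q z) (p z)) :
    ∃ (φ : FullPseudogroup R) (s : φ.source → Z), Measurable s ∧ φ.source = p '' S ∧
      φ.target = q '' S ∧ ∀ x, s x ∈ S ∧ p (s x) = x ∧ q (s x) = φ.toPartialEquiv x := by
  obtain ⟨σ, hσ, hσS⟩ := exists_measurable_section_of_injOn hp hS hpS
  obtain ⟨τ, hτ, hτS⟩ := exists_measurable_section_of_injOn hq hS hqS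
  have hσp : ∀ z (hz : z ∈ S), σ ⟨p z, z, hz, rfl⟩ = z := fun z hz =>
    hpS (hσS _).1 hz (hσS _).2
  have hτq : ∀ z (hz : z ∈ S), τ ⟨q z, z, hz, rfl⟩ = z := fun z hz =>
    hqS (hτS _).1 hz (hτS _).2
  -- The values outside `p '' S` and `q '' S` are junk; the identity is taken there.
  let φ : PartialEquiv X X :=
    { toFun := fun x => if h : x ∈ p '' S then q (σ ⟨x, h⟩) else x
      invFun := fun y => if h : y ∈ q '' S then p (τ ⟨y, h⟩) else y
      source := p '' S
      target := q '' S
      map_source' := by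
        rintro x hx
        rw [dif_pos hx]
        exact ⟨_, (hσS _).1, rfl⟩
      map_target' := by
        rintro x hx
        rw [dif_pos hx]
        exact ⟨_, (hτS _).1, rfl⟩
      left_inv' := by
        rintro _ ⟨z, hz, rfl⟩
        rw [dif_pos (Set.mem_image_of_mem p hz), hσp z hz, dif_pos (Set.mem_image_of_mem q hz),
          hτq z hz]
      right_inv' := by
        rintro _ ⟨z, hz, rfl⟩
        rw [dif_pos (Set.mem_image_of_mem q hz), hτq z hz, dif_pos (Set.mem_image_of_mem p hz),
          hσp z hz] }
  have h1 : ∀ x : p '' S, φ x = q (σ x) := fun x => dif_pos x.2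
  have h2 : ∀ y : q '' S, φ.symm y = p (τ y) := fun y => dif_pos y.2
  refine ⟨⟨φ, hS.image_of_measurable_injOn hp hpS, hS.image_of_measurable_injOn hq hqS, ?_, ?_,
    ?_⟩, σ, hσ, rfl, rfl, fun x => ⟨(hσS x).1, (hσS x).2, (h1 x).symm⟩⟩
  · change Measurable fun x : p '' S => φ x
    rw [funext h1]
    exact hq.comp hσ
  · change Measurable fun y : q '' S => φ.symm y
    rw [funext h2]
    exact hp.comp hτ
  · intro x hx
    have h := hR _ (hσS ⟨x, hx⟩).1
    rw [← h1 ⟨x, hx⟩, (hσS ⟨x, hx⟩).2] at h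
    exact h

/-! ### Systems of partial sections of vertices and edges. -/

section Sections

variable {X : Type u} [MeasurableSpace X] {R : BorelEqRel X}
  {V : Type v} {E : Type w} [MeasurableSpace V] [MeasurableSpace E]

/-- Countably many partial Borel sections of the vertices, indexed by a rooted tree of indices in
which the parent of `k + 1` is `par k`, each section being joined to its parent by a partial section
of edges, such that every orbit of vertices is met by exactly one of them. -/
structure TreeOfSections (A : BorelGraphField R V E) where
  -- A domain may be empty, when a stage of the construction reaches nothing new. Such indices are
  -- dropped only in the quotient graph.
  dom : ℕ → Set X
  measurableSet_dom : ∀ k, MeasurableSet (dom k)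
  dom_zero : dom 0 = Set.univ
  par : ℕ → ℕ
  par_le : ∀ k, par k ≤ k
  dom_succ : ∀ k, dom (k + 1) ⊆ dom (par k)
  σ : ∀ k, dom k → V
  measurable_σ : ∀ k, Measurable (σ k)
  proj_σ : ∀ k x, A.vert.proj (σ k x) = x
  τ : ∀ k, dom (k + 1) → E
  measurable_τ : ∀ k, Measurable (τ k)
  org_τ : ∀ k x, A.graph.org (τ k x) = σ (par k) ⟨x, dom_succ k x.2⟩
  ter_τ : ∀ k x, A.graph.ter (τ k x) = σ (k + 1) x
  -- Nothing is asked of two points of the same section: they may well be equivalent.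
  eq_of_orbitRel : ∀ i j x y, A.vert.OrbitRel (σ i x) (σ j y) → i = j
  exists_orbitRel : ∀ v, ∃ k x, A.vert.OrbitRel v (σ k x)

namespace TreeOfSections

variable {A : BorelGraphField R V E} (𝒯 : TreeOfSections A)

theorem proj_τ (k : ℕ) (x : 𝒯.dom (k + 1)) : A.edge.proj (𝒯.τ k x) = x := by
  rw [← A.ter_morphism.proj_map, 𝒯.ter_τ, 𝒯.proj_σ]

theorem injective_σ (k : ℕ) : Function.Injective (𝒯.σ k) := fun x y h => Subtype.ext <| by
  rw [← 𝒯.proj_σ, ← 𝒯.proj_σ, h]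

theorem injective_τ (k : ℕ) : Function.Injective (𝒯.τ k) := fun x y h => Subtype.ext <| by
  rw [← 𝒯.proj_τ, ← 𝒯.proj_τ, h]

/-- The indices of the nonempty sections of vertices. -/
abbrev Index : Type := {k : ℕ // (𝒯.dom k).Nonempty}

/-- The indices of the nonempty sections of edges. -/
abbrev EdgeIndex : Type := {k : ℕ // (𝒯.dom (k + 1)).Nonempty}

theorem dom_par_nonempty (k : 𝒯.EdgeIndex) : (𝒯.dom (𝒯.par k)).Nonempty :=
  k.2.mono (𝒯.dom_succ k)

theorem mem_dom_zero (x : X) : x ∈ 𝒯.dom 0 := 𝒯.dom_zero ▸ Set.mem_univ x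

theorem par_ne_succ (k : ℕ) : 𝒯.par k ≠ k + 1 := (Nat.lt_succ_of_le (𝒯.par_le k)).ne

/-- The edges in the orbit of an edge of the tree of sections, in either direction. -/
def treeEdges : Set E :=
  {e | ∃ k x, A.edge.OrbitRel e (𝒯.τ k x) ∨ A.edge.OrbitRel e (A.graph.inv (𝒯.τ k x))}

end TreeOfSections

/-- Countably many partial isomorphisms with partial sections of edges, which represent the orbits
of edges outside a tree of sections. -/
structure ComplementarySections {A : BorelGraphField R V E} (𝒯 : TreeOfSections A) where
  src : ℕ → ℕ
  tgt : ℕ → ℕ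
  φ : ℕ → FullPseudogroup R
  source_subset : ∀ i, (φ i).source ⊆ 𝒯.dom (src i)
  target_subset : ∀ i, (φ i).target ⊆ 𝒯.dom (tgt i)
  s : ∀ i, (φ i).source → E
  measurable_s : ∀ i, Measurable (s i)
  proj_s : ∀ i x, A.edge.proj (s i x) = x
  org_s : ∀ i x, A.graph.org (s i x) = 𝒯.σ (src i) ⟨x, source_subset i x.2⟩
  ter_s : ∀ i (x : (φ i).source), A.vert.OrbitRel
    (𝒯.σ (tgt i) ⟨(φ i).toPartialEquiv x, target_subset i ((φ i).toPartialEquiv.map_source x.2)⟩)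
    (A.graph.ter (s i x))
  eq_of_orbitRel : ∀ i j x y, A.edge.OrbitRel (s i x) (s j y) → i = j
  notMem_treeEdges : ∀ i x, s i x ∉ 𝒯.treeEdges
  -- Since `treeEdges` is stable under reversal, an edge outside it and its opposite are both
  -- represented here. The partition of the edges therefore needs only one direction of each
  -- complementary section.
  exists_orbitRel : ∀ e, e ∈ 𝒯.treeEdges ∨ ∃ i x, A.edge.OrbitRel e (s i x)

theorem ComplementarySections.injective_s {A : BorelGraphField R V E} {𝒯 : TreeOfSections A}
    (𝒮 : ComplementarySections 𝒯) (i : ℕ) : Function.Injective (𝒮.s i) :=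
  fun x y h => Subtype.ext <| by
  rw [← 𝒮.proj_s, ← 𝒮.proj_s, h]

end Sections

/-! ### Existence of the systems of sections. -/

section Existence

variable {X : Type u} [MeasurableSpace X] {R : BorelEqRel X}
  {V : Type v} {E : Type w} [MeasurableSpace V] [MeasurableSpace E]

open Set in
theorem FiberedAction.exists_iUnion_injOn [StandardBorelSpace X] {F : Type w}
    [MeasurableSpace F] [StandardBorelSpace F]
    (Φ : FiberedAction R F) : ∃ C : ℕ → Set F, (∀ n, MeasurableSet (C n)) ∧
      (∀ n, InjOn Φ.proj (C n)) ∧ univ = ⋃ n, C n :=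
  MeasurableSet.univ.exists_iUnion_injOn_of_countable_fiber Φ.measurable_proj
    fun x => (Φ.countable_fiber x).mono inter_subset_right

open Set in
-- Over each point of the base, the first piece of the enumeration that meets the fibre is used.
theorem FiberedAction.exists_section [StandardBorelSpace X] {F : Type w}
    [MeasurableSpace F] [StandardBorelSpace F]
    (Φ : FiberedAction R F) (hs : Function.Surjective Φ.proj) :
    ∃ C : Set F, MeasurableSet C ∧ InjOn Φ.proj C ∧ Φ.proj '' C = univ := by
  classical
  obtain ⟨C, hm, hi, hC⟩ := Φ.exists_iUnion_injOn
  refine ⟨⋃ n, (C n \ Φ.proj ⁻¹' ⋃ l : Fin n, Φ.proj '' C l), ?_, ?_, ?_⟩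
  · exact MeasurableSet.iUnion fun n => (hm n).diff <| Φ.measurable_proj <|
      MeasurableSet.iUnion fun l => (hm l).image_of_measurable_injOn Φ.measurable_proj (hi l)
  · intro f hf g hg hfg
    obtain ⟨n, hn, hn'⟩ := mem_iUnion.1 hf
    obtain ⟨m, hm, hm'⟩ := mem_iUnion.1 hg
    rcases lt_trichotomy n m with h | rfl | h
    · exact (hm' (mem_preimage.2 (mem_iUnion.2 ⟨⟨n, h⟩, f, hn, hfg⟩))).elim
    · exact hi n hn hm hfg
    · exact (hn' (mem_preimage.2 (mem_iUnion.2 ⟨⟨m, h⟩, g, hm, hfg.symm⟩))).elim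
  · refine eq_univ_of_forall fun x => ?_
    have hex : ∃ n, x ∈ Φ.proj '' C n := by
      obtain ⟨f, rfl⟩ := hs x
      obtain ⟨n, hn⟩ := mem_iUnion.1 (hC ▸ mem_univ f : f ∈ ⋃ n, C n)
      exact ⟨n, f, hn, rfl⟩
    obtain ⟨f, hf, hfx⟩ := Nat.find_spec hex
    refine ⟨f, mem_iUnion.2 ⟨Nat.find hex, hf, fun h => ?_⟩, hfx⟩
    obtain ⟨l, hl⟩ := mem_iUnion.1 h
    exact Nat.find_min hex l.2 (hfx ▸ hl)

namespace BorelGraphField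

variable (A : BorelGraphField R V E)

/-- In a field of connected graphs, a set of vertices which contains a point of each fibre and which
contains the terminus of an edge whenever it contains the origin is everything. -/
theorem eq_univ_of_ter_mem (hA : A.IsArboretum) {S : Set V}
    (h0 : ∀ x, ∃ v ∈ S, A.vert.proj v = x)
    (h : ∀ e, A.graph.org e ∈ S → A.graph.ter e ∈ S) : S = Set.univ := by
  refine Set.eq_univ_of_forall fun v => ?_
  obtain ⟨r, hr, hrv⟩ := h0 (A.vert.proj v)
  have hreach := (hA (A.vert.proj v)).2.2.1.preconnected ⟨r, hrv⟩ ⟨v, rfl⟩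
  rw [SimpleGraph.reachable_iff_reflTransGen] at hreach
  suffices ∀ p, Relation.ReflTransGen (A.fiber (A.vert.proj v)).adjGraph.Adj ⟨r, hrv⟩ p →
    p.1 ∈ S from this _ hreach
  intro p hp
  induction hp with
  | refl => exact hr
  | tail _ hadj ih =>
    obtain ⟨-, e, ho, ht⟩ := hadj
    rw [← ht]
    rw [← ho] at ih
    exact h e.1 ih

/-- The vertices reached at each stage of the construction of a tree of sections, from the vertices
`C₀` and along the sets of edges `W n`. -/
def treeVertices (C₀ : Set V) (W : ℕ → Set E) : ℕ → Set V
  | 0 => C₀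
  | k + 1 => A.graph.ter '' {e ∈ W (Nat.unpair k).2 |
      A.graph.org e ∈ treeVertices C₀ W (Nat.unpair k).1 ∧
      ∀ j : Fin (k + 1), A.graph.ter e ∉ A.vert.saturation (treeVertices C₀ W j)}
  termination_by k => k
  decreasing_by
    · exact Nat.lt_succ_of_le (Nat.unpair_left_le k)
    · exact j.2

/-- The edges joining the vertices reached at the stage `k + 1` to their parents. -/
def newEdges (C₀ : Set V) (W : ℕ → Set E) (k : ℕ) : Set E :=
  {e ∈ W (Nat.unpair k).2 | A.graph.org e ∈ A.treeVertices C₀ W (Nat.unpair k).1 ∧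
    ∀ j : Fin (k + 1), A.graph.ter e ∉ A.vert.saturation (A.treeVertices C₀ W j)}

theorem treeVertices_zero (C₀ : Set V) (W : ℕ → Set E) : A.treeVertices C₀ W 0 = C₀ := by
  rw [treeVertices]

theorem treeVertices_succ (C₀ : Set V) (W : ℕ → Set E) (k : ℕ) :
    A.treeVertices C₀ W (k + 1) = A.graph.ter '' A.newEdges C₀ W k := by
  rw [treeVertices, newEdges]

variable [StandardBorelSpace X] [StandardBorelSpace V] [StandardBorelSpace E]

open Set in
theorem exists_treeOfSections (hA : A.IsArboretum) : Nonempty (TreeOfSections A) := by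
  obtain ⟨C₀, hC₀m, hC₀i, hC₀⟩ := A.vert.exists_section A.vert_surjective
  obtain ⟨W, hWm, hWi, hW⟩ := A.edge.exists_iUnion_injOn
  set C := A.treeVertices C₀ W with hCdef
  set D := A.newEdges C₀ W with hDdef
  have hC0 : C 0 = C₀ := A.treeVertices_zero C₀ W
  have hCs : ∀ k, C (k + 1) = A.graph.ter '' D k := A.treeVertices_succ C₀ W
  have hDW : ∀ k, D k ⊆ W (Nat.unpair k).2 := fun k e he => he.1
  have hDi : ∀ k, InjOn A.edge.proj (D k) := fun k => (hWi _).mono (hDW k)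
  have hter : ∀ k, InjOn A.graph.ter (D k) := fun k e he e' he' h => hDi k he he' <| by
    rw [← A.ter_morphism.proj_map, ← A.ter_morphism.proj_map, h]
  have hsat : ∀ {S : Set V}, MeasurableSet S → MeasurableSet (A.vert.saturation S) :=
    fun hS => A.vert.orbit.measurableSet_saturate hS
  -- The edges of stage `k` depend only on vertices reached up to stage `k`, so measurability
  -- follows by strong induction.
  have hDm' : ∀ k, (∀ j ≤ k, MeasurableSet (C j)) → MeasurableSet (D k) := by
    intro k hk
    have : D k = W (Nat.unpair k).2 ∩ (A.graph.org ⁻¹' C (Nat.unpair k).1 ∩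
        ⋂ j : Fin (k + 1), A.graph.ter ⁻¹' (A.vert.saturation (C j))ᶜ) := by
      ext e
      simp only [hDdef, newEdges, hCdef, mem_inter_iff, mem_iInter, mem_ofPred_eq, mem_preimage,
        mem_compl_iff]
    rw [this]
    refine (hWm _).inter ((A.org_morphism.measurable (hk _ (Nat.unpair_left_le k))).inter ?_)
    exact MeasurableSet.iInter fun j =>
      A.ter_morphism.measurable (hsat (hk j (Nat.le_of_lt_succ j.2))).compl
  have hCm : ∀ k, MeasurableSet (C k) := by
    intro k
    induction k using Nat.strong_induction_on with
    | _ k ih =>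
      cases k with
      | zero => rwa [hC0]
      | succ k =>
        rw [hCs]
        exact (hDm' k fun j hj => ih j (Nat.lt_succ_of_le hj)).image_of_measurable_injOn
          A.ter_morphism.measurable (hter k)
  have hDm : ∀ k, MeasurableSet (D k) := fun k => hDm' k fun j _ => hCm j
  have hCi : ∀ k, InjOn A.vert.proj (C k) := by
    rintro (_ | k)
    · rwa [hC0]
    · rw [hCs]
      rintro _ ⟨e, he, rfl⟩ _ ⟨e', he', rfl⟩ h
      rw [A.ter_morphism.proj_map, A.ter_morphism.proj_map] at h
      rw [hDi k he he' h]
  have hdom : ∀ k, A.vert.proj '' C (k + 1) = A.edge.proj '' D k := by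
    intro k
    rw [hCs, image_image]
    exact image_congr fun e _ => A.ter_morphism.proj_map e
  choose σ hσm hσ using fun k => exists_measurable_section_of_injOn A.vert.measurable_proj
    (hCm k) (hCi k)
  choose τ hτm hτ using fun k => exists_measurable_section_of_injOn A.edge.measurable_proj
    (hDm k) (hDi k)
  have hdisj : ∀ i j, i < j → ∀ v ∈ C i, ∀ v' ∈ C j, ¬ A.vert.OrbitRel v' v := by
    rintro i (_ | j) hij v hv v' hv' h
    · exact absurd hij (Nat.not_lt_zero i)
    rw [hCs] at hv'
    obtain ⟨e, he, rfl⟩ := hv'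
    exact he.2.2 ⟨i, hij⟩ ⟨v, hv, h⟩
  -- The vertices equivalent to a reached one contain a point of each fibre and are closed under
  -- passing along an edge, so connectedness of the fibres gives everything.
  have hcover : (⋃ k, A.vert.saturation (C k)) = univ := by
    refine A.eq_univ_of_ter_mem hA (fun x => ?_) fun e he => ?_
    · obtain ⟨v, hv, hvx⟩ : x ∈ A.vert.proj '' C₀ := hC₀ ▸ mem_univ x
      exact ⟨v, mem_iUnion.2 ⟨0, v, hC0.symm ▸ hv, .refl _ v⟩, hvx⟩
    · obtain ⟨m, v, hv, hev⟩ := mem_iUnion.1 he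
      obtain ⟨e', hee', he'v⟩ := A.org_morphism.exists_lift hev.symm
      obtain ⟨n, hn⟩ := mem_iUnion.1 (hW ▸ mem_univ e' : e' ∈ ⋃ n, W n)
      have hmem : A.graph.ter e' ∈ ⋃ k, A.vert.saturation (C k) := by
        by_contra hno
        rw [mem_iUnion, not_exists] at hno
        -- One visit to each pair `(m, n)` is enough: a terminus not attached at that stage had
        -- already been met up to translation.
        refine hno (Nat.pair m n + 1) ⟨_, ?_, .refl _ _⟩
        rw [hCs]
        refine mem_image_of_mem _ ⟨?_, ?_, fun j => hno j⟩
        · rwa [Nat.unpair_pair]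
        · rw [Nat.unpair_pair, he'v]
          exact hv
      obtain ⟨k, v', hv', h'⟩ := mem_iUnion.1 hmem
      exact mem_iUnion.2 ⟨k, v', hv', ((A.ter_morphism.orbitRel hee').symm).trans h'⟩
  have hsub : ∀ k, A.vert.proj '' C (k + 1) ⊆ A.vert.proj '' C (Nat.unpair k).1 := by
    intro k
    rw [hdom]
    rintro _ ⟨e, he, rfl⟩
    exact ⟨_, he.2.1, A.org_morphism.proj_map e⟩
  refine ⟨{
    dom := fun k => A.vert.proj '' C k
    measurableSet_dom := fun k =>
      (hCm k).image_of_measurable_injOn A.vert.measurable_proj (hCi k)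
    dom_zero := by rw [hC0, hC₀]
    par := fun k => (Nat.unpair k).1
    par_le := Nat.unpair_left_le
    dom_succ := hsub
    σ := σ
    measurable_σ := hσm
    proj_σ := fun k x => (hσ k x).2
    τ := fun k x => τ k ⟨x, hdom k ▸ x.2⟩
    measurable_τ := fun k => (hτm k).comp (Measurable.subtype_mk measurable_subtype_coe)
    org_τ := fun k x => hCi (Nat.unpair k).1 (hτ k _).1.2.1 (hσ _ _).1 ?_
    ter_τ := fun k x => hCi (k + 1) ?_ (hσ _ _).1 ?_
    eq_of_orbitRel := fun i j x y h => ?_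
    exists_orbitRel := fun v => ?_ }⟩
  · rw [A.org_morphism.proj_map, (hτ k _).2, (hσ _ _).2]
  · have := mem_image_of_mem A.graph.ter (hτ k ⟨x, hdom k ▸ x.2⟩).1
    rwa [← hCs] at this
  · rw [A.ter_morphism.proj_map, (hτ k _).2, (hσ _ _).2]
  · rcases lt_trichotomy i j with hij | hij | hij
    · exact absurd h.symm (hdisj i j hij _ (hσ i x).1 _ (hσ j y).1)
    · exact hij
    · exact absurd h (hdisj j i hij _ (hσ j y).1 _ (hσ i x).1)
  · obtain ⟨k, v', hv', h⟩ := mem_iUnion.1 (hcover ▸ mem_univ v)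
    refine ⟨k, ⟨_, v', hv', rfl⟩, ?_⟩
    have : σ k ⟨_, v', hv', rfl⟩ = v' := hCi k (hσ k _).1 hv' (hσ k _).2
    rwa [this]

open Set in
theorem exists_complementarySections {A : BorelGraphField R V E} (𝒯 : TreeOfSections A) :
    Nonempty (ComplementarySections 𝒯) := by
  let p : E × V → X := fun q => A.edge.proj q.1
  let q : E × V → X := fun q => A.vert.proj q.2
  have hp : Measurable p := A.edge.measurable_proj.comp measurable_fst
  have hq : Measurable q := A.vert.measurable_proj.comp measurable_snd
  -- The second coordinate is a translate of the terminus; it will be chosen on a section, and its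
  -- base point is the value of the partial isomorphism.
  let Z : Set (E × V) := {z | A.vert.OrbitRel z.2 (A.graph.ter z.1)}
  have hZ : MeasurableSet Z := (measurable_snd.prodMk
    (A.ter_morphism.measurable.comp measurable_fst))
      (FiberedAction.measurableSet_orbitRel (Φ := A.vert))
  have hZR : ∀ z ∈ Z, R.toSetoid (q z) (p z) := fun z hz => by
    have := hz.rel
    rwa [A.ter_morphism.proj_map] at this
  obtain ⟨P, hPm, hPi, hP⟩ := hZ.exists_iUnion_injOn_of_countable_fiber hp fun x => by
    refine ((A.edge.countable_fiber x).prod (A.vert.countable_preimage_class x)).mono ?_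
    rintro z ⟨hz, rfl⟩
    exact ⟨rfl, R.toSetoid.symm (hZR z hz)⟩
  obtain ⟨Q, hQm, hQi, hQ⟩ := hZ.exists_iUnion_injOn_of_countable_fiber hq fun x => by
    refine ((A.edge.countable_preimage_class x).prod (A.vert.countable_fiber x)).mono ?_
    rintro z ⟨hz, rfl⟩
    exact ⟨hZR z hz, rfl⟩
  have : ∀ i, StandardBorelSpace (𝒯.dom i) := fun i => (𝒯.measurableSet_dom i).standardBorel
  have hσr : ∀ k, MeasurableSet (range (𝒯.σ k)) := fun k =>
    ((𝒯.measurable_σ k).measurableEmbedding (𝒯.injective_σ k)).measurableSet_range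
  have hτi' : ∀ k, Function.Injective fun x => A.graph.inv (𝒯.τ k x) := fun k x y h =>
    𝒯.injective_τ k (by simpa [A.graph.inv_inv] using congrArg A.graph.inv h)
  have hsat : ∀ {S : Set E}, MeasurableSet S → MeasurableSet (A.edge.saturation S) :=
    fun hS => A.edge.orbit.measurableSet_saturate hS
  have hT : MeasurableSet 𝒯.treeEdges := by
    have : 𝒯.treeEdges = ⋃ k, (A.edge.saturation (range (𝒯.τ k)) ∪
        A.edge.saturation (range fun x => A.graph.inv (𝒯.τ k x))) := by
      ext e
      simp [TreeOfSections.treeEdges, FiberedAction.saturation, exists_or]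
    rw [this]
    refine MeasurableSet.iUnion fun k => (hsat ?_).union (hsat ?_)
    · exact ((𝒯.measurable_τ k).measurableEmbedding (𝒯.injective_τ k)).measurableSet_range
    · exact ((A.inv_morphism.measurable.comp (𝒯.measurable_τ k)).measurableEmbedding
        (hτi' k)).measurableSet_range
  have hTsat : ∀ {e e'}, A.edge.OrbitRel e e' → e' ∈ 𝒯.treeEdges → e ∈ 𝒯.treeEdges := by
    rintro e e' h ⟨k, x, hx⟩
    exact ⟨k, x, hx.imp h.trans h.trans⟩
  obtain ⟨idx, hidx⟩ := exists_surjective_nat (ℕ × ℕ × ℕ × ℕ)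
  -- An index encodes a piece where `p` is injective, a piece where `q` is injective, and the
  -- sections carrying the origin and the translated terminus.
  let B : ℕ → Set (E × V) := fun i => P (idx i).1 ∩ Q (idx i).2.1 ∩
    (Prod.fst ⁻¹' (A.graph.org ⁻¹' range (𝒯.σ (idx i).2.2.1) ∩ 𝒯.treeEdgesᶜ) ∩
      Prod.snd ⁻¹' range (𝒯.σ (idx i).2.2.2))
  have hBm : ∀ i, MeasurableSet (B i) := fun i => ((hPm _).inter (hQm _)).inter
    ((measurable_fst ((A.org_morphism.measurable (hσr _)).inter hT.compl)).inter
      (measurable_snd (hσr _)))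
  have hBp : ∀ i, InjOn p (B i) := fun i => (hPi (idx i).1).mono fun z hz => hz.1.1
  have hBq : ∀ i, InjOn q (B i) := fun i => (hQi (idx i).2.1).mono fun z hz => hz.1.2
  have hBfst : ∀ i, InjOn Prod.fst (B i) := fun i z hz z' hz' h =>
    hBp i hz hz' (congrArg A.edge.proj h)
  let B' : ℕ → Set (E × V) := fun i =>
    B i ∩ ⋂ l : Fin i, Prod.fst ⁻¹' (A.edge.saturation (Prod.fst '' B l))ᶜ
  have hB'm : ∀ i, MeasurableSet (B' i) := fun i => (hBm i).inter <| MeasurableSet.iInter fun l =>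
    measurable_fst (hsat ((hBm l).image_of_measurable_injOn measurable_fst (hBfst l))).compl
  have hBZ : ∀ i, B i ⊆ Z := fun i z hz => hP ▸ mem_iUnion.2 ⟨_, hz.1.1⟩
  choose φ s hsm hsrc htgt hs using fun i => exists_fullPseudogroup_of_injOn R hp hq (hB'm i)
    ((hBp i).mono inter_subset_left) ((hBq i).mono inter_subset_left)
    (fun z hz => hZR z (hBZ i hz.1))
  have hsB : ∀ i x, s i x ∈ B i := fun i x => (hs i x).1.1
  have hdisj : ∀ i j, i < j → ∀ z ∈ B' i, ∀ z' ∈ B' j, ¬ A.edge.OrbitRel z'.1 z.1 :=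
    fun i j hij z hz z' hz' h => mem_iInter.1 hz'.2 ⟨i, hij⟩ ⟨z.1, mem_image_of_mem _ hz.1, h⟩
  have hsrc' : ∀ i, (φ i).source ⊆ 𝒯.dom (idx i).2.2.1 := by
    intro i
    rw [hsrc]
    rintro _ ⟨z, hz, rfl⟩
    obtain ⟨y, hy⟩ := hz.1.2.1.1
    have : p z = y := by rw [← 𝒯.proj_σ, hy, A.org_morphism.proj_map]
    exact this ▸ y.2
  have htgt' : ∀ i, (φ i).target ⊆ 𝒯.dom (idx i).2.2.2 := by
    intro i
    rw [htgt]
    rintro _ ⟨z, hz, rfl⟩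
    obtain ⟨y, hy⟩ := hz.1.2.2
    have : q z = y := by rw [← 𝒯.proj_σ, hy]
    exact this ▸ y.2
  have hσeq : ∀ k v (x : 𝒯.dom k), v ∈ range (𝒯.σ k) → A.vert.proj v = x → v = 𝒯.σ k x := by
    rintro k _ x ⟨y, rfl⟩ h
    rw [𝒯.proj_σ] at h
    rw [Subtype.ext h]
  refine ⟨{
    src := fun i => (idx i).2.2.1
    tgt := fun i => (idx i).2.2.2
    φ := φ
    source_subset := hsrc'
    target_subset := htgt'
    s := fun i x => (s i x).1
    measurable_s := fun i => measurable_fst.comp (hsm i)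
    proj_s := fun i x => (hs i x).2.1
    org_s := fun i x => hσeq _ _ _ (hsB i x).2.1.1
      ((A.org_morphism.proj_map _).trans (hs i x).2.1)
    ter_s := fun i (x : (φ i).source) => ?_
    eq_of_orbitRel := fun i j x y h => ?_
    notMem_treeEdges := fun i x => (hsB i x).2.1.2
    exists_orbitRel := fun e => ?_ }⟩
  · rw [← hσeq _ (s i x).2 ⟨_, _⟩ (hsB i x).2.2 (hs i x).2.2]
    exact hBZ i (hsB i x)
  · rcases lt_trichotomy i j with hij | hij | hij
    · exact absurd h.symm (hdisj i j hij _ (hs i x).1 _ (hs j y).1)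
    · exact hij
    · exact absurd h (hdisj j i hij _ (hs j y).1 _ (hs i x).1)
  · classical
    refine or_iff_not_imp_left.2 fun he => ?_
    -- Translating `e` brings its origin onto a section; the terminus is then moved separately. The
    -- least index `i` that works is the one not removed in `B'`.
    have hex : ∃ i, ∃ z ∈ B i, A.edge.OrbitRel e z.1 := by
      obtain ⟨m, x, hx⟩ := 𝒯.exists_orbitRel (A.graph.org e)
      obtain ⟨e', hee', he'x⟩ := A.org_morphism.exists_lift hx.symm
      obtain ⟨m', y, hy⟩ := 𝒯.exists_orbitRel (A.graph.ter e')
      have hmem : (e', 𝒯.σ m' y) ∈ Z := hy.symm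
      obtain ⟨n, hn⟩ := mem_iUnion.1 (hP ▸ hmem)
      obtain ⟨n', hn'⟩ := mem_iUnion.1 (hQ ▸ hmem)
      obtain ⟨i, hi⟩ := hidx (n, n', m, m')
      refine ⟨i, (e', 𝒯.σ m' y), ?_, hee'.symm⟩
      dsimp only [B]
      rw [hi]
      exact ⟨⟨hn, hn'⟩, ⟨⟨x, he'x.symm⟩, fun h => he (hTsat hee'.symm h)⟩, y, rfl⟩
    obtain ⟨z, hz, hez⟩ := Nat.find_spec hex
    have hzB' : z ∈ B' (Nat.find hex) := by
      refine ⟨hz, mem_iInter.2 fun l => ?_⟩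
      rintro ⟨_, ⟨z', hz', rfl⟩, h⟩
      exact Nat.find_min hex l.2 ⟨z', hz', hez.trans h⟩
    have hx : p z ∈ (φ (Nat.find hex)).source := by
      rw [hsrc]
      exact mem_image_of_mem p hzB'
    refine ⟨Nat.find hex, ⟨p z, hx⟩, ?_⟩
    rwa [hBp _ (hsB _ ⟨p z, hx⟩) hz (hs _ _).2.1]

end BorelGraphField

end Existence

/-! ### The quotient graph of relations and its maximal subtree. -/

section Assembly

variable {X : Type u} [MeasurableSpace X] [StandardBorelSpace X] {R : BorelEqRel X}
  {V : Type v} {E : Type w} [MeasurableSpace V] [MeasurableSpace E]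
  [StandardBorelSpace V] [StandardBorelSpace E] {A : BorelGraphField R V E}

namespace TreeOfSections

variable (𝒯 : TreeOfSections A)

/-- The relation carried by a section of vertices. -/
def vertSpace (k : ℕ) : BorelRelSpace.{u} :=
  have : StandardBorelSpace (𝒯.dom k) := (𝒯.measurableSet_dom k).standardBorel
  ⟨𝒯.dom k, A.vert.orbit.comap (𝒯.σ k) (𝒯.measurable_σ k) (𝒯.injective_σ k)⟩

/-- The relation carried by a section of edges. -/
def edgeSpace (k : ℕ) : BorelRelSpace.{u} :=
  have : StandardBorelSpace (𝒯.dom (k + 1)) := (𝒯.measurableSet_dom (k + 1)).standardBorel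
  ⟨𝒯.dom (k + 1), A.edge.orbit.comap (𝒯.τ k) (𝒯.measurable_τ k) (𝒯.injective_τ k)⟩

end TreeOfSections

namespace ComplementarySections

variable {𝒯 : TreeOfSections A} (𝒮 : ComplementarySections 𝒯)

/-- The indices of the nonempty complementary sections. -/
abbrev Index : Type := {i : ℕ // (𝒮.φ i).source.Nonempty}

/-- The relation carried by a complementary section. -/
def space (i : ℕ) : BorelRelSpace.{u} :=
  have : StandardBorelSpace (𝒮.φ i).source := (𝒮.φ i).measurableSet_source.standardBorel
  ⟨(𝒮.φ i).source, A.edge.orbit.comap (𝒮.s i) (𝒮.measurable_s i) (𝒮.injective_s i)⟩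

/-- The image of a point of the domain of a partial isomorphism. -/
def map (i : ℕ) (x : (𝒮.φ i).source) : 𝒯.dom (𝒮.tgt i) :=
  ⟨(𝒮.φ i).toPartialEquiv x, 𝒮.target_subset i ((𝒮.φ i).toPartialEquiv.map_source x.2)⟩

/-- The edges of the quotient graph. -/
abbrev QEdge : Type := (𝒯.EdgeIndex ⊕ 𝒮.Index) × Bool

/-- The terminus of an edge of the quotient graph. -/
def qTer : 𝒮.QEdge → 𝒯.Index
  | (.inl k, true) => ⟨k + 1, k.2⟩
  | (.inl k, false) => ⟨𝒯.par k, 𝒯.dom_par_nonempty k⟩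
  | (.inr i, true) => ⟨𝒮.tgt i, i.2.elim fun x hx => ⟨_, (𝒮.map i ⟨x, hx⟩).2⟩⟩
  | (.inr i, false) => ⟨𝒮.src i, i.2.mono (𝒮.source_subset i)⟩

/-- The quotient graph. -/
def qGraph : SerreGraph 𝒯.Index 𝒮.QEdge where
  org a := 𝒮.qTer (a.1, !a.2)
  ter a := 𝒮.qTer a
  inv a := (a.1, !a.2)
  inv_inv a := Prod.ext rfl (Bool.not_not a.2)
  inv_ne a h := Bool.not_ne_self a.2 (congrArg Prod.snd h)
  org_inv a := congrArg 𝒮.qTer (Prod.ext rfl (Bool.not_not a.2))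

/-- The relation carried by an edge of the quotient graph. -/
def qSpace : 𝒯.EdgeIndex ⊕ 𝒮.Index → BorelRelSpace.{u}
  | .inl k => 𝒯.edgeSpace k
  | .inr i => 𝒮.space i

/-- The injection attached to an edge of the quotient graph. -/
def qMor : ∀ a : 𝒮.QEdge, (𝒮.qSpace a.1).carrier → (𝒯.vertSpace (𝒮.qTer a)).carrier
  | (.inl _, true) => fun x => x
  | (.inl k, false) => fun x => ⟨x.1, 𝒯.dom_succ k x.2⟩
  | (.inr i, true) => fun x => 𝒮.map i x
  | (.inr i, false) => fun x => ⟨x.1, 𝒮.source_subset i x.2⟩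

/-- The edge of `A` represented by a point of the space of an edge of the quotient graph. -/
def qOnE : ∀ a : 𝒮.QEdge, (𝒮.qSpace a.1).carrier → E
  | (.inl k, true) => fun x => 𝒯.τ k x
  | (.inl k, false) => fun x => A.graph.inv (𝒯.τ k x)
  | (.inr i, true) => fun x => 𝒮.s i x
  | (.inr i, false) => fun x => A.graph.inv (𝒮.s i x)

theorem qSpace_rel_iff (a : 𝒮.QEdge) (x y : (𝒮.qSpace a.1).carrier) :
    (𝒮.qSpace a.1).rel.toSetoid x y ↔ A.edge.OrbitRel (𝒮.qOnE a x) (𝒮.qOnE a y) := by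
  have hinv : ∀ e e', A.edge.OrbitRel e e' ↔
      A.edge.OrbitRel (A.graph.inv e) (A.graph.inv e') := fun e e' =>
    ⟨A.inv_morphism.orbitRel, fun h => by
      simpa only [A.graph.inv_inv] using A.inv_morphism.orbitRel h⟩
  match a with
  | (.inl k, true) => exact Iff.rfl
  | (.inl k, false) => exact hinv _ _
  | (.inr i, true) => exact Iff.rfl
  | (.inr i, false) => exact hinv _ _

/-- Equivalence replaces equality because a complementary edge ends on a section only after
translation by its partial isomorphism. Equivalence suffices for the injections to respect the
relations. -/
theorem orbitRel_qMor (a : 𝒮.QEdge) (x : (𝒮.qSpace a.1).carrier) :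
    A.vert.OrbitRel (𝒯.σ (𝒮.qTer a) (𝒮.qMor a x)) (A.graph.ter (𝒮.qOnE a x)) := by
  match a with
  | (.inl k, true) => exact 𝒯.ter_τ k x ▸ .refl _ _
  | (.inl k, false) =>
    have : A.graph.ter (𝒮.qOnE (.inl k, false) x) = 𝒯.σ (𝒯.par k) ⟨x.1, 𝒯.dom_succ k x.2⟩ :=
      (A.graph.ter_inv _).trans (𝒯.org_τ k x)
    exact this ▸ .refl _ _
  | (.inr i, true) => exact 𝒮.ter_s i x
  | (.inr i, false) =>
    have : A.graph.ter (𝒮.qOnE (.inr i, false) x) = 𝒯.σ (𝒮.src i) ⟨x.1, 𝒮.source_subset i x.2⟩ :=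
      (A.graph.ter_inv _).trans (𝒮.org_s i x)
    exact this ▸ .refl _ _

theorem measurable_qMor (a : 𝒮.QEdge) : Measurable (𝒮.qMor a) := by
  match a with
  | (.inl k, true) => exact measurable_id
  | (.inl k, false) => exact Measurable.subtype_mk measurable_subtype_coe
  | (.inr i, true) => exact Measurable.subtype_mk (𝒮.φ i).measurable_toFun
  | (.inr i, false) => exact Measurable.subtype_mk measurable_subtype_coe

theorem injective_qMor (a : 𝒮.QEdge) : Function.Injective (𝒮.qMor a) := by
  match a with
  | (.inl k, true) => exact Function.injective_id
  | (.inl k, false) => exact fun x y h => Subtype.ext (congrArg (fun z : 𝒯.dom (𝒯.par k) => z.1) h)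
  | (.inr i, true) =>
    exact fun x y h => Subtype.ext
      ((𝒮.φ i).toPartialEquiv.injOn x.2 y.2 (congrArg Subtype.val h))
  | (.inr i, false) => exact fun x y h => Subtype.ext (congrArg (fun z : 𝒯.dom _ => z.1) h)

theorem measurable_qOnE (a : 𝒮.QEdge) : Measurable (𝒮.qOnE a) := by
  match a with
  | (.inl k, true) => exact 𝒯.measurable_τ k
  | (.inl k, false) => exact A.inv_morphism.measurable.comp (𝒯.measurable_τ k)
  | (.inr i, true) => exact 𝒮.measurable_s i
  | (.inr i, false) => exact A.inv_morphism.measurable.comp (𝒮.measurable_s i)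

/-- The quotient graph of relations. -/
def qRelGraph : GraphOfRelations.{u} where
  Vert := 𝒯.Index
  Edge := 𝒮.QEdge
  graph := 𝒮.qGraph
  vRel k := 𝒯.vertSpace k
  eRel a := 𝒮.qSpace a.1
  eRel_inv _ := rfl
  mor := 𝒮.qMor
  measurable_mor := 𝒮.measurable_qMor
  injective_mor := 𝒮.injective_qMor
  mor_rel a x y h := ((𝒮.orbitRel_qMor a x).trans
    (A.ter_morphism.orbitRel ((𝒮.qSpace_rel_iff a x y).1 h))).trans (𝒮.orbitRel_qMor a y).symm

/-- The edges of the maximal subtree of the quotient graph. -/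
def qTreeEdges : Set 𝒮.QEdge := {a | a.1.isLeft}

theorem inv_mem_qTreeEdges (a : 𝒮.QEdge) (ha : a ∈ 𝒮.qTreeEdges) :
    𝒮.qGraph.inv a ∈ 𝒮.qTreeEdges := ha

theorem inr_notMem_qTreeEdges (i : 𝒮.Index) (b : Bool) : (Sum.inr i, b) ∉ 𝒮.qTreeEdges :=
  Bool.false_ne_true

/-- Two vertices are joined in the maximal subtree if one of them is the parent of the other. -/
theorem adj_iff {P Q : 𝒯.Index} :
    (𝒮.qGraph.restrictEdges 𝒮.qTreeEdges 𝒮.inv_mem_qTreeEdges).adjGraph.Adj P Q ↔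
      ∃ k : ℕ, (P.1 = 𝒯.par k ∧ Q.1 = k + 1) ∨ (Q.1 = 𝒯.par k ∧ P.1 = k + 1) := by
  constructor
  · rintro ⟨-, ⟨⟨k | i, b⟩, ha⟩, rfl, rfl⟩
    · cases b
      · exact ⟨k, .inr ⟨rfl, rfl⟩⟩
      · exact ⟨k, .inl ⟨rfl, rfl⟩⟩
    · exact absurd ha (𝒮.inr_notMem_qTreeEdges _ _)
  · obtain ⟨P, hP⟩ := P
    obtain ⟨Q, hQ⟩ := Q
    rintro ⟨k, ⟨h, h'⟩ | ⟨h, h'⟩⟩ <;> dsimp only at h h' <;> subst h h'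
    · exact ⟨fun h => 𝒯.par_ne_succ k (congrArg Subtype.val h),
        ⟨(.inl ⟨k, hQ⟩, true), rfl⟩, rfl, rfl⟩
    · exact ⟨fun h => 𝒯.par_ne_succ k (congrArg Subtype.val h).symm,
        ⟨(.inl ⟨k, hP⟩, false), rfl⟩, rfl, rfl⟩

/-- Every index `k + 1` has exactly one smaller neighbour, `par k`. Descending to parents reaches
`0`, and the larger end of an edge determines it up to direction. -/
theorem isTree_restrictEdges [Nonempty X] :
    (𝒮.qGraph.restrictEdges 𝒮.qTreeEdges 𝒮.inv_mem_qTreeEdges).IsTree := by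
  refine ⟨?_, ?_, ⟨?_, ?_⟩⟩
  · rintro ⟨⟨k | i, b⟩, ha⟩ h
    · cases b
      · exact 𝒯.par_ne_succ k (congrArg Subtype.val h).symm
      · exact 𝒯.par_ne_succ k (congrArg Subtype.val h)
    · exact absurd ha (𝒮.inr_notMem_qTreeEdges _ _)
  · rintro ⟨⟨k | i, b⟩, ha⟩ ⟨⟨l | j, c⟩, hc⟩ h h'
    · have h1 := congrArg Subtype.val h
      have h2 := congrArg Subtype.val h'
      have hk := 𝒯.par_le k
      have hl := 𝒯.par_le l
      cases b <;> cases c <;>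
        simp only [SerreGraph.restrictEdges, qGraph, qTer, Bool.not_true, Bool.not_false] at h1 h2
      · have : k = l := Subtype.ext (by omega)
        subst this; rfl
      · omega
      · omega
      · have : k = l := Subtype.ext (by omega)
        subst this; rfl
    · exact absurd hc (𝒮.inr_notMem_qTreeEdges _ _)
    · exact absurd ha (𝒮.inr_notMem_qTreeEdges _ _)
    · exact absurd ha (𝒮.inr_notMem_qTreeEdges _ _)
  · have h0 : (𝒯.dom 0).Nonempty := 𝒯.dom_zero ▸ Set.univ_nonempty
    rw [SimpleGraph.connected_iff_exists_forall_reachable]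
    refine ⟨⟨0, h0⟩, ?_⟩
    rintro ⟨k, hk⟩
    induction k using Nat.strong_induction_on with
    | _ k ih =>
      cases k with
      | zero => rfl
      | succ k =>
        refine (ih (𝒯.par k) (Nat.lt_succ_of_le (𝒯.par_le k)) (hk.mono (𝒯.dom_succ k))).trans ?_
        exact SimpleGraph.Adj.reachable (𝒮.adj_iff.2 ⟨k, .inl ⟨rfl, rfl⟩⟩)
  -- At the largest vertex `Q` of a circuit, both neighbours are smaller than `Q`, hence both are
  -- its parent; but the second and the penultimate vertices of a circuit differ.
  · classical
    intro P c hc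
    obtain ⟨Q, hQ, hmax⟩ := c.support.toFinset.exists_max_image Subtype.val
      ⟨P, List.mem_toFinset.2 c.start_mem_support⟩
    have hQ' : Q ∈ c.support := List.mem_toFinset.1 hQ
    have hc' := hc.rotate hQ'
    have hle : ∀ S ∈ (c.rotate Q hQ').support, S.1 ≤ Q.1 := fun S hS =>
      hmax S (List.mem_toFinset.2 ((c.mem_support_rotate_iff Q hQ').1 hS))
    refine hc'.snd_ne_penultimate ?_
    have h1 := 𝒮.adj_iff.1 ((c.rotate Q hQ').adj_snd hc'.not_nil)
    have h2 := 𝒮.adj_iff.1 ((c.rotate Q hQ').adj_penultimate hc'.not_nil)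
    have h1' : (c.rotate Q hQ').snd.1 ≤ Q.1 := hle _ (SimpleGraph.Walk.getVert_mem_support _ _)
    have h2' : (c.rotate Q hQ').penultimate.1 ≤ Q.1 :=
      hle _ (SimpleGraph.Walk.getVert_mem_support _ _)
    obtain ⟨k, hk⟩ := h1
    obtain ⟨l, hl⟩ := h2
    have hpk := 𝒯.par_le k
    have hpl := 𝒯.par_le l
    have : k = l := by omega
    subst this
    exact Subtype.ext (by omega)

end ComplementarySections

end Assembly

/-! ### The representation and the desingularization. -/

section Desingularization

variable {X : Type u} [MeasurableSpace X] [StandardBorelSpace X] {R : BorelEqRel X}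
  {V : Type v} {E : Type w} [MeasurableSpace V] [MeasurableSpace E]
  [StandardBorelSpace V] [StandardBorelSpace E] {A : BorelGraphField R V E}

theorem measurable_sigma {ι : Type*} {β : ι → Type*} [∀ i, MeasurableSpace (β i)] {γ : Type*}
    [MeasurableSpace γ] {f : Sigma β → γ} (h : ∀ i, Measurable fun x => f ⟨i, x⟩) :
    Measurable f :=
  fun _ hs => MeasurableSpace.measurableSet_iInf.2 fun i => h i hs

namespace ComplementarySections

variable {𝒯 : TreeOfSections A} (𝒮 : ComplementarySections 𝒯)

/-- The point of `X` under a point of the quotient graph of relations. -/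
def point (p : 𝒮.qRelGraph.TotV) : X := (show 𝒯.dom p.1.1 from p.2).1

/-- The vertex of `A` represented by a point of the quotient graph of relations. -/
def onV (p : 𝒮.qRelGraph.TotV) : V := 𝒯.σ p.1.1 p.2

/-- The edge of `A` represented by a point of an edge of the quotient graph of relations. -/
def onE (e : 𝒮.qRelGraph.TotE) : E := 𝒮.qOnE e.1 e.2

theorem proj_onV (p : 𝒮.qRelGraph.TotV) : A.vert.proj (𝒮.onV p) = 𝒮.point p := 𝒯.proj_σ _ _

theorem ter_onE (e : 𝒮.qRelGraph.TotE) (he : e.1 ∈ 𝒮.qTreeEdges) :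
    A.graph.ter (𝒮.onE e) = 𝒮.onV (𝒮.qRelGraph.ter e) := by
  obtain ⟨⟨k | i, b⟩, x⟩ := e
  · cases b
    · exact (A.graph.ter_inv _).trans (𝒯.org_τ k x)
    · exact 𝒯.ter_τ k x
  · exact absurd he (𝒮.inr_notMem_qTreeEdges _ _)

theorem inv_onE (e : 𝒮.qRelGraph.TotE) :
    A.graph.inv (𝒮.onE e) = 𝒮.onE (𝒮.qRelGraph.flip e) := by
  obtain ⟨⟨k | i, b⟩, x⟩ := e <;> cases b
  · exact A.graph.inv_inv _
  · rfl
  · exact A.graph.inv_inv _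
  · rfl

theorem org_onE (e : 𝒮.qRelGraph.TotE) (he : e.1 ∈ 𝒮.qTreeEdges) :
    A.graph.org (𝒮.onE e) = 𝒮.onV (𝒮.qRelGraph.org e) := by
  rw [← A.graph.ter_inv, inv_onE]
  exact 𝒮.ter_onE _ (𝒮.inv_mem_qTreeEdges _ he)

/-- Tree edges are represented by genuine edges of `A`, which stay in one fibre. The base point is
thus an invariant of the generated relation, and this gives uniqueness in the root space. -/
theorem point_eq_of_step {p q : 𝒮.qRelGraph.TotV} (h : 𝒮.qRelGraph.Step 𝒮.qTreeEdges p q) :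
    𝒮.point p = 𝒮.point q := by
  obtain ⟨e, he, rfl, rfl⟩ := h
  rw [← proj_onV, ← proj_onV, ← 𝒮.ter_onE e he, ← 𝒮.org_onE e he, A.org_morphism.proj_map,
    A.ter_morphism.proj_map]

theorem point_eq_of_eqvGen {p q : 𝒮.qRelGraph.TotV}
    (h : Relation.EqvGen (𝒮.qRelGraph.Step 𝒮.qTreeEdges) p q) : 𝒮.point p = 𝒮.point q := by
  induction h with
  | rel _ _ h => exact 𝒮.point_eq_of_step h
  | refl => rfl
  | symm _ _ _ ih => exact ih.symm
  | trans _ _ _ _ _ ih ih' => exact ih.trans ih'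

theorem injective_onV : Function.Injective 𝒮.onV := by
  rintro ⟨k, x⟩ ⟨l, y⟩ h
  obtain rfl : k = l := Subtype.ext (𝒯.eq_of_orbitRel k.1 l.1 x y
    (show A.vert.OrbitRel (𝒮.onV ⟨k, x⟩) (𝒮.onV ⟨l, y⟩) from h ▸ .refl _ _))
  exact congrArg (Sigma.mk k) (𝒯.injective_σ k.1 h)

theorem injective_qOnE (a : 𝒮.QEdge) : Function.Injective (𝒮.qOnE a) := by
  have hinv : Function.Injective A.graph.inv := fun e e' h => by
    rw [← A.graph.inv_inv e, h, A.graph.inv_inv]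
  match a with
  | (.inl k, true) => exact 𝒯.injective_τ k
  | (.inl k, false) => exact hinv.comp (𝒯.injective_τ k)
  | (.inr i, true) => exact 𝒮.injective_s i
  | (.inr i, false) => exact hinv.comp (𝒮.injective_s i)

theorem exists_orbitRel_tree_edge {e : E} (he : e ∈ 𝒯.treeEdges) :
    ∃ a ∈ 𝒮.qTreeEdges, ∃ x, A.edge.OrbitRel e (𝒮.qOnE a x) := by
  obtain ⟨k, x, h | h⟩ := he
  · exact ⟨(.inl ⟨k, x, x.2⟩, true), rfl, x, h⟩
  · exact ⟨(.inl ⟨k, x, x.2⟩, false), rfl, x, h⟩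

theorem mem_treeEdges_of_orbitRel {e : E} {a : 𝒮.QEdge} (ha : a ∈ 𝒮.qTreeEdges)
    {x : (𝒮.qSpace a.1).carrier} (h : A.edge.OrbitRel e (𝒮.qOnE a x)) : e ∈ 𝒯.treeEdges := by
  obtain ⟨k | i, b⟩ := a
  · cases b
    · exact ⟨k, x, .inr h⟩
    · exact ⟨k, x, .inl h⟩
  · exact absurd ha (𝒮.inr_notMem_qTreeEdges _ _)

theorem inducesIso_source (i : ℕ) (f : (𝒮.φ i).source → X) (hf : ∀ x, f x = x) :
    InducesIso (𝒮.space i) f (𝒮.φ i).source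
      (fun x y => A.edge.OrbitRel (𝒮.s i x) (𝒮.s i y)) := by
  obtain rfl : f = Subtype.val := funext hf
  exact ⟨Subtype.val_injective, Subtype.range_coe, fun _ _ _ _ => Iff.rfl⟩

theorem inducesIso_target (i : ℕ) (f : (𝒮.φ i).source → X)
    (hf : ∀ x, f x = (𝒮.φ i).toPartialEquiv x) :
    InducesIso (𝒮.space i) f (𝒮.φ i).target
      ((𝒮.φ i).conj fun x y => A.edge.OrbitRel (𝒮.s i x) (𝒮.s i y)) := by
  obtain rfl : f = fun x : (𝒮.φ i).source => (𝒮.φ i).toPartialEquiv x := funext hf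
  refine ⟨fun x y h => Subtype.ext ((𝒮.φ i).toPartialEquiv.injOn x.2 y.2 h), ?_, ?_⟩
  · exact (Set.image_eq_range _ _).symm.trans (𝒮.φ i).toPartialEquiv.image_source_eq_target
  · intro (e : (𝒮.φ i).source) (e' : (𝒮.φ i).source) h h'
    have hsymm : ∀ (x : (𝒮.φ i).source) (hx : (𝒮.φ i).toPartialEquiv x ∈ (𝒮.φ i).target),
        (⟨(𝒮.φ i).toPartialEquiv.symm ((𝒮.φ i).toPartialEquiv x),
          (𝒮.φ i).toPartialEquiv.map_target hx⟩ : (𝒮.φ i).source) = x :=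
      fun x _ => Subtype.ext ((𝒮.φ i).toPartialEquiv.left_inv x.2)
    rw [FullPseudogroup.conj, hsymm e h, hsymm e' h']
    exact Iff.rfl

variable [Nonempty X]

/-- The vertex of the quotient graph which carries `X`. -/
def qRoot : 𝒯.Index := ⟨0, 𝒯.dom_zero ▸ Set.univ_nonempty⟩

/-- The domain of a section is contained in that of its parent, so one can descend to the root above
the same base point. -/
theorem eqvGen_root (p : 𝒮.qRelGraph.TotV) :
    Relation.EqvGen (𝒮.qRelGraph.Step 𝒮.qTreeEdges)
      ⟨qRoot, (⟨𝒮.point p, 𝒯.mem_dom_zero _⟩ : 𝒯.dom 0)⟩ p := by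
  obtain ⟨⟨k, hk⟩, x⟩ := p
  induction k using Nat.strong_induction_on with
  | _ k ih =>
    cases k with
    | zero => exact .refl _
    | succ k =>
      refine .trans _ _ _ (ih (𝒯.par k) (Nat.lt_succ_of_le (𝒯.par_le k)) (hk.mono (𝒯.dom_succ k))
        (⟨_, 𝒯.dom_succ k (show 𝒯.dom (k + 1) from x).2⟩ : 𝒯.dom (𝒯.par k))) (.rel _ _ ?_)
      exact ⟨⟨(.inl ⟨k, hk⟩, true), x⟩, rfl, rfl, rfl⟩

/-- The maximal subtree of the quotient graph of relations, with its root. -/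
def qTree : 𝒮.qRelGraph.RootedMaximalTree where
  edges := 𝒮.qTreeEdges
  inv_mem := 𝒮.inv_mem_qTreeEdges
  isTree := 𝒮.isTree_restrictEdges
  root := qRoot
  root_fundamental p := ⟨_, 𝒮.eqvGen_root p, fun (_ : 𝒯.dom 0) hy =>
    Subtype.ext (𝒮.point_eq_of_eqvGen hy)⟩

/-- Edges of the quotient tree which represent edges of the same orbit are equal. -/
theorem eq_of_orbitRel_onE {e e' : 𝒮.qRelGraph.TotE} (he : e.1 ∈ 𝒮.qTreeEdges)
    (he' : e'.1 ∈ 𝒮.qTreeEdges) (h : A.edge.OrbitRel (𝒮.onE e) (𝒮.onE e')) : e.1 = e'.1 := by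
  -- Both ends of the two edges lie in the same orbits, hence on the same sections, and a tree has
  -- no multiple edges. In particular no tree edge is equivalent to its opposite.
  have ht := A.ter_morphism.orbitRel h
  have ho := A.org_morphism.orbitRel h
  rw [𝒮.ter_onE e he, 𝒮.ter_onE e' he'] at ht
  rw [𝒮.org_onE e he, 𝒮.org_onE e' he'] at ho
  exact congrArg Subtype.val (𝒮.isTree_restrictEdges.2.1 ⟨e.1, he⟩ ⟨e'.1, he'⟩
    (Subtype.ext (𝒯.eq_of_orbitRel _ _ _ _ ho)) (Subtype.ext (𝒯.eq_of_orbitRel _ _ _ _ ht)))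

/-- The representation in `A` of the maximal subtree. -/
def representation : TreeRepresentation 𝒮.qTree A where
  base := fun y : 𝒯.dom 0 => y.1
  base_embedding := .subtype_coe (𝒯.measurableSet_dom 0)
  onV := 𝒮.onV
  onE e := 𝒮.onE e.1
  measurable_onV := measurable_sigma fun k => 𝒯.measurable_σ k.1
  measurable_onE := (measurable_sigma (f := 𝒮.onE) 𝒮.measurable_qOnE).comp
    measurable_subtype_coe
  injective_onV := 𝒮.injective_onV
  injective_onE := by
    rintro ⟨⟨a, x⟩, ha⟩ ⟨⟨b, y⟩, hb⟩ h
    obtain rfl : a = b := 𝒮.eq_of_orbitRel_onE ha hb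
      (show A.edge.OrbitRel (𝒮.onE ⟨a, x⟩) (𝒮.onE ⟨b, y⟩) from
        (show 𝒮.onE ⟨a, x⟩ = 𝒮.onE ⟨b, y⟩ from h) ▸ .refl _ _)
    have := 𝒮.injective_qOnE a h
    subst this
    rfl
  proj_onV y p h := (𝒮.proj_onV p).trans (𝒮.point_eq_of_eqvGen h).symm
  org_onE e := 𝒮.org_onE e.1 e.2
  ter_onE e := 𝒮.ter_onE e.1 e.2
  inv_onE e := 𝒮.inv_onE e.1
  vRel_iff _ _ _ := Iff.rfl
  eRel_iff a _ := 𝒮.qSpace_rel_iff a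

/-- The complementary section carried by an edge outside the maximal subtree. -/
def sectionIndex : {a : 𝒮.qRelGraph.Edge // a ∈ {a : 𝒮.QEdge | a.2 = true} ∧
    a ∉ 𝒮.qTree.edges} → 𝒮.Index
  | ⟨(.inl _, _), h⟩ => absurd rfl h.2
  | ⟨(.inr i, _), _⟩ => i

theorem eq_sectionIndex (a : {a : 𝒮.qRelGraph.Edge // a ∈ {a : 𝒮.QEdge | a.2 = true} ∧
    a ∉ 𝒮.qTree.edges}) : a.1 = (Sum.inr (𝒮.sectionIndex a), true) := by
  obtain ⟨⟨k | i, b⟩, h, h'⟩ := a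
  · exact absurd rfl h'
  · exact Prod.ext rfl h

theorem edge_partition : IsPartitionFamily
    (Sum.elim (fun a : 𝒮.qTree.edges => A.edge.saturation (𝒮.representation.edgeRep a))
      (fun a : {a : 𝒮.qRelGraph.Edge // a ∈ {a : 𝒮.QEdge | a.2 = true} ∧ a ∉ 𝒮.qTree.edges} =>
        A.edge.saturation (Set.range (𝒮.s (𝒮.sectionIndex a))))) := by
  refine ⟨?_, ?_, ?_⟩
  · rintro (⟨⟨k | i, b⟩, ha⟩ | a)
    · obtain ⟨x, hx⟩ := k.2
      exact ⟨_, _, ⟨(⟨x, hx⟩ : 𝒯.dom (k + 1)), rfl⟩, .refl _ _⟩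
    · exact absurd ha (𝒮.inr_notMem_qTreeEdges _ _)
    · obtain ⟨x, hx⟩ := (𝒮.sectionIndex a).2
      exact ⟨_, _, ⟨⟨x, hx⟩, rfl⟩, .refl _ _⟩
  · rintro (a | a) (b | b) hab <;> rw [Set.disjoint_left]
    · rintro e ⟨_, ⟨x, rfl⟩, h⟩ ⟨_, ⟨y, rfl⟩, h'⟩
      exact hab (congrArg Sum.inl (Subtype.ext (𝒮.eq_of_orbitRel_onE
        (e := ⟨a.1, x⟩) (e' := ⟨b.1, y⟩) a.2 b.2 (h.symm.trans h'))))
    · rintro e ⟨_, ⟨x, rfl⟩, h⟩ ⟨_, ⟨y, rfl⟩, h'⟩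
      exact 𝒮.notMem_treeEdges _ y (𝒮.mem_treeEdges_of_orbitRel a.2 (h'.symm.trans h))
    · rintro e ⟨_, ⟨x, rfl⟩, h⟩ ⟨_, ⟨y, rfl⟩, h'⟩
      exact 𝒮.notMem_treeEdges _ x (𝒮.mem_treeEdges_of_orbitRel b.2 (h.symm.trans h'))
    · rintro e ⟨_, ⟨x, rfl⟩, h⟩ ⟨_, ⟨y, rfl⟩, h'⟩
      have hi := 𝒮.eq_of_orbitRel _ _ _ _ (h.symm.trans h')
      refine hab (congrArg Sum.inr (Subtype.ext ?_))
      rw [𝒮.eq_sectionIndex a, 𝒮.eq_sectionIndex b, Subtype.ext hi]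
  · refine Set.eq_univ_of_forall fun e => Set.mem_iUnion.2 ?_
    rcases 𝒮.exists_orbitRel e with he | ⟨i, x, h⟩
    · obtain ⟨a, ha, x, h⟩ := 𝒮.exists_orbitRel_tree_edge he
      exact ⟨.inl ⟨a, ha⟩, _, ⟨x, rfl⟩, h⟩
    · exact ⟨.inr ⟨(.inr ⟨i, x, x.2⟩, true), rfl, 𝒮.inr_notMem_qTreeEdges _ _⟩, _, ⟨x, rfl⟩, h⟩

theorem isArboretumOfRepresentatives : 𝒮.representation.IsArboretumOfRepresentatives := by
  refine ⟨?_, ?_, ?_⟩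
  · rintro ⟨k, x, hx⟩
    exact ⟨_, _, ⟨(⟨x, hx⟩ : 𝒯.dom k), rfl⟩, .refl _ _⟩
  · intro P Q hPQ
    rw [Set.disjoint_left]
    rintro v ⟨_, ⟨x, rfl⟩, h⟩ ⟨_, ⟨y, rfl⟩, h'⟩
    exact hPQ (Subtype.ext (𝒯.eq_of_orbitRel _ _ _ _ (h.symm.trans h')))
  · refine Set.eq_univ_of_forall fun v => Set.mem_iUnion.2 ?_
    obtain ⟨k, x, h⟩ := 𝒯.exists_orbitRel v
    exact ⟨⟨k, x, x.2⟩, _, ⟨x, rfl⟩, h⟩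

/-- The desingularization built from a tree of sections and complementary sections. -/
def desingularization : Desingularization A where
  G := 𝒮.qRelGraph
  orientation := {a : 𝒮.QEdge | a.2 = true}
  orientation_iff a := by
    change a.2 = true ↔ ¬ (!a.2) = true
    cases a.2 <;> simp
  T := 𝒮.qTree
  χ := 𝒮.representation
  representatives := 𝒮.isArboretumOfRepresentatives
  base_surjective x := ⟨(⟨x, 𝒯.mem_dom_zero x⟩ : 𝒯.dom 0), rfl⟩
  φ a := 𝒮.φ (𝒮.sectionIndex a)
  s a := 𝒮.s (𝒮.sectionIndex a)
  measurable_s _ := 𝒮.measurable_s _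
  proj_s _ := 𝒮.proj_s _
  org_s := by
    rintro ⟨⟨k | i, b⟩, h, h'⟩ x
    · exact absurd rfl h'
    obtain rfl : b = true := h
    exact ⟨(⟨x, 𝒮.source_subset i x.2⟩ : 𝒯.dom (𝒮.src i)), (𝒮.org_s i x).symm⟩
  ter_s := by
    rintro ⟨⟨k | i, b⟩, h, h'⟩ x
    · exact absurd rfl h'
    obtain rfl : b = true := h
    -- The translation in this orbit relation goes to the base point of a vertex of the section,
    -- which is the value of the partial isomorphism at `x`.
    obtain ⟨hR, hact⟩ := 𝒮.ter_s i x
    have hp : A.vert.proj (𝒯.σ (𝒮.tgt i) (𝒮.map i x)) = (𝒮.φ i).toPartialEquiv x :=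
      𝒯.proj_σ (𝒮.tgt i) (𝒮.map i x)
    have hR' : R.toSetoid ((𝒮.φ i).toPartialEquiv x) (A.vert.proj (A.graph.ter (𝒮.s i x))) := by
      rw [← hp]
      exact hR
    exact ⟨hR', 𝒮.map i x, hact.symm.trans (A.vert.act_congr hp rfl _ _)⟩
  iso_org := by
    rintro ⟨⟨k | i, b⟩, h, h'⟩
    · exact absurd rfl h'
    obtain rfl : b = true := h
    exact 𝒮.inducesIso_source i _ fun _ => 𝒯.proj_σ _ _
  iso_ter := by
    rintro ⟨⟨k | i, b⟩, h, h'⟩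
    · exact absurd rfl h'
    obtain rfl : b = true := h
    exact 𝒮.inducesIso_target i _ fun _ => 𝒯.proj_σ _ _
  φ_org := by
    rintro ⟨⟨k | i, b⟩, h, h'⟩ x
    · exact absurd rfl h'
    obtain rfl : b = true := h
    have h1 : 𝒮.representation.toBase (𝒮.qRelGraph.org ⟨(.inr i, true), x⟩) =
      (show (𝒮.φ i).source from x).1 := 𝒯.proj_σ _ _
    have h2 : 𝒮.representation.toBase (𝒮.qRelGraph.ter ⟨(.inr i, true), x⟩) =
      (𝒮.φ i).toPartialEquiv (show (𝒮.φ i).source from x).1 := 𝒯.proj_σ _ _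
    exact (congrArg _ h1).trans h2.symm
  edge_partition := 𝒮.edge_partition

end ComplementarySections

end Desingularization

theorem mainTheorem6 {X : Type u} [MeasurableSpace X] [StandardBorelSpace X] [Nonempty X]
    (R : BorelEqRel X) {V : Type v} [MeasurableSpace V] [StandardBorelSpace V]
    {E : Type w} [MeasurableSpace E] [StandardBorelSpace E]
    (A : BorelGraphField R V E) (hA : A.IsArboretum) :
    Nonempty (Desingularization A) := by
  obtain ⟨𝒯⟩ := A.exists_treeOfSections hA
  obtain ⟨𝒮⟩ := BorelGraphField.exists_complementarySections 𝒯
  exact ⟨𝒮.desingularization⟩
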